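/- Let $n\ge 3$ and let $V_n=\mathbb{Z}_2^{2n}$, with vectors written $x=(a_1,b_1,\dots,a_n,b_n)$, carry the symplectic form $\langle x,x'\rangle=\sum_{i=1}^n (a_ib_i'+b_ia_i')$. Let $\mathcal{G}_n$ be the point-line geometry whose points are the nonzero vectors of $V_n$ and whose lines are the sets $\{a,b,a+b\}$ with $a\ne b$ nonzero and $\langle a,b\rangle=0$. A geometric hyperplane of $\mathcal{G}_n$ is a proper subset $A$ of the point set such that every line either meets $A$ in exactly one point or is contained in $A$. A Veldkamp line of $\mathcal{G}_n$ is an intersection $A\cap B$ of two distinct geometric hyperplanes; a geometric hyperplane is incident with a Veldkamp line if it contains it. Put $Q_0(x)=\sum_{i=1}^n a_ib_i$ and $Q_p(x)=Q_0(x)+\langle p,x\rangle$ for $p\in V_n$, and let $$C_p=\{x\ne 0:\langle p,x\rangle=0\}\ (p\neq 0),\qquad H_p=\{x\neq 0: Q_p(x)=0\}\ (p\in V_n).$$ The Arf invariant of $H_p$ is the Arf invariant of $Q_p$, i.e. the value in $\mathbb{Z}_2$ that $Q_p$ takes most often; it equals $Q_0(p)$. The geometry $\mathcal{G}_n$ has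 a Veldkamp space: no geometric hyperplane is properly contained in another one, and for any three distinct geometric hyperplanes $A,B,C$ with $A\cap B\subseteq C$ one has $A\cap B=A\cap C$. The group $Sp(2n,2)$ of linear automorphisms of $V_n$ preserving $\langle\cdot,\cdot\rangle$ has exactly five orbits on the set of Veldkamp lines of $\mathcal{G}_n$, namely the five classes below. Each Veldkamp line is incident with exactly three geometric hyperplanes. In each class, the number of incident hyperplanes of type $C$, of type $H$ with Arf invariant $0$, and of type $H$ with Arf invariant $1$ is the given triple; every line of the class has the given size; and the class consists of the given number of lines. 1. The sets $C_a\cap C_b$ with $a\neq b$ nonzero and $\langle a,b\rangle=0$: triple $(3,0,0)$, size $4^{n-1}-1$, number $\frac13(4^n-1)(4^{n-1}-1)$. 2. The sets $C_a\cap C_b$ with $a\neq b$ nonzero and $\langle a,b\rangle=1$: triple $(3,0,0)$, size $4^{n-1}-1$, number $\frac13 4^{n-1}(4^n-1)$. 3. The sets $H_a\cap H_b$ with $a\ne b$, both of Arf invariant $0$: triple $(1,2,0)$, size $4^{n-1}+2^{n-1}-1$, number $2^{n-3}(4^n-1)(2^n+2)$. 4. The sets $H_a\cap H_b$ with $H_a$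 of Arf invariant $0$ and $H_b$ of Arf invariant $1$: triple $(1,1,1)$, size $4^{n-1}-1$, number $4^{n-1}(4^n-1)$. 5. The sets $H_a\cap H_b$ with $a\neq b$, both of Arf invariant $1$: triple $(1,0,2)$, size $4^{n-1}-2^{n-1}-1$, number $2^{n-3}(4^n-1)(2^n-2)$. -/

import Mathlib

open scoped Pointwise

/-! Point-line geometries, geometric hyperplanes and Veldkamp lines. -/

/-- A simple point-line geometry: a set of points, and a set of lines, each line being
identified with the set of points incident with it. -/
structure PointLineGeometry (α : Type*) where
  points : Set α
  lines : Set (Set α)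
  lines_subset : ∀ l ∈ lines, l ⊆ points

namespace PointLineGeometry

variable {α : Type*} (G : PointLineGeometry α)

/-- `H` is a proper subset of the point set that meets every line in exactly one point or
contains it. -/
def IsGeometricHyperplane (H : Set α) : Prop :=
  H ⊆ G.points ∧ (∀ l ∈ G.lines, (H ∩ l).ncard = 1 ∨ l ⊆ H) ∧ H ≠ G.points

/-- No geometric hyperplane is properly contained in another one. -/
def HasVeldkampPoints : Prop :=
  ∀ A B : Set α, G.IsGeometricHyperplane A → G.IsGeometricHyperplane B → ¬ A ⊂ B

/-- For distinct hyperplanes `A`, `B`, `C`, if `A ∩ B ⊆ C` then `A ∩ B = A ∩ C`. -/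
def HasVeldkampLines : Prop :=
  ∀ A B C : Set α, G.IsGeometricHyperplane A → G.IsGeometricHyperplane B →
    G.IsGeometricHyperplane C → A ≠ B → A ≠ C → B ≠ C → A ∩ B ⊆ C → A ∩ B = A ∩ C

/-- The lines of the Veldkamp space: the intersections of pairs of distinct hyperplanes. -/
def veldkampLines : Set (Set α) :=
  {l | ∃ A B : Set α, G.IsGeometricHyperplane A ∧ G.IsGeometricHyperplane B ∧ A ≠ B ∧ l = A ∩ B}

/-- The hyperplanes (points of the Veldkamp space) incident with the Veldkamp line `l`:
incidence is reverse inclusion. -/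
def incidentHyperplanes (l : Set α) : Set (Set α) :=
  {A | G.IsGeometricHyperplane A ∧ l ⊆ A}

end PointLineGeometry

namespace QubitGeometry

/-- The space `ℤ₂²ⁿ`; the vector `(a₁, b₁, …, aₙ, bₙ)` is `x` with `x i = (aᵢ, bᵢ)`. -/
abbrev V (n : ℕ) : Type := Fin n → ZMod 2 × ZMod 2

variable {n : ℕ}

/-- The symplectic form `⟨x, y⟩ = ∑ (aᵢ b'ᵢ + bᵢ a'ᵢ)`. -/
def symp (x y : V n) : ZMod 2 := ∑ i, ((x i).1 * (y i).2 + (x i).2 * (y i).1)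

/-- The geometry `𝒢ₙ` of the `n`-qubit Pauli group: the nonzero vectors of `V n`, and the
lines `{a, b, a + b}` with `a ≠ b` orthogonal points. -/
def geometry (n : ℕ) : PointLineGeometry (V n) where
  points := {x | x ≠ 0}
  lines := {l | ∃ a b : V n, a ≠ 0 ∧ b ≠ 0 ∧ a ≠ b ∧ symp a b = 0 ∧ l = {a, b, a + b}}
  lines_subset := by
    rintro l ⟨a, b, ha, hb, hab, -, rfl⟩ x hx
    have h2 : ∀ z : ZMod 2, z + z = 0 := by decide
    have h3 : ∀ v : V n, v + v = 0 := fun v => by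
      funext i
      exact Prod.ext (h2 _) (h2 _)
    rcases hx with rfl | rfl | rfl
    · exact ha
    · exact hb
    · intro h
      exact hab (add_right_cancel (h.trans (h3 b).symm))

/-- The symplectic group `Sp(2n, 2)`: the linear automorphisms of `V n` preserving the form.
It acts on `V n`, and pointwise on subsets of `V n`. -/
def Sp (n : ℕ) : Subgroup (V n ≃ₗ[ZMod 2] V n) where
  carrier := {g | ∀ x y, symp (g x) (g y) = symp x y}
  one_mem' := fun _ _ => rfl
  mul_mem' := fun {g h} hg hh x y => (hg (h x) (h y)).trans (hh x y)
  inv_mem' := fun {g} hg x y => by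
    have := hg (g.symm x) (g.symm y)
    rw [g.apply_symm_apply, g.apply_symm_apply] at this
    exact this.symm

/-- The orbit of a set of points under `Sp(2n, 2)`. -/
def spOrbit (l : Set (V n)) : Set (Set (V n)) := MulAction.orbit (Sp n) l

/-- The quadratic form `Q₀(x) = ∑ aᵢ bᵢ`. -/
def Q₀ (x : V n) : ZMod 2 := ∑ i, (x i).1 * (x i).2

/-- The quadratic form `Q_p(x) = Q₀(x) + ⟨p, x⟩`. -/
def Q (p x : V n) : ZMod 2 := Q₀ x + symp p x

/-- The Arf invariant of a form: the value in `ℤ₂` that it takes most often. (The default in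
case of a tie does not matter: the forms `Q p` never have one.) -/
noncomputable def arf (q : V n → ZMod 2) : ZMod 2 :=
  if {x | q x = 0}.ncard < {x | q x = 1}.ncard then 1 else 0

/-- The set `C_p` of points orthogonal to `p`. -/
def C (p : V n) : Set (V n) := {x | x ≠ 0 ∧ symp p x = 0}

/-- The set `H_p` of points at which `Q_p` vanishes. -/
def H (p : V n) : Set (V n) := {x | x ≠ 0 ∧ Q p x = 0}

/-- The `C`-hyperplanes. -/
def cHyperplanes (n : ℕ) : Set (Set (V n)) := {A | ∃ p : V n, p ≠ 0 ∧ A = C p}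

/-- The `H`-hyperplanes with Arf invariant `ε`. -/
def hHyperplanes (n : ℕ) (ε : ZMod 2) : Set (Set (V n)) :=
  {A | ∃ p : V n, arf (Q p) = ε ∧ A = H p}

/-- The intersections `C_a ∩ C_b` with `a ≠ b` nonzero and `⟨a, b⟩ = ε`. -/
def ccLines (n : ℕ) (ε : ZMod 2) : Set (Set (V n)) :=
  {l | ∃ a b : V n, a ≠ 0 ∧ b ≠ 0 ∧ a ≠ b ∧ symp a b = ε ∧ l = C a ∩ C b}

/-- The intersections `H_a ∩ H_b` with `a ≠ b` and Arf invariants `ε` and `δ`. -/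
def hhLines (n : ℕ) (ε δ : ZMod 2) : Set (Set (V n)) :=
  {l | ∃ a b : V n, a ≠ b ∧ arf (Q a) = ε ∧ arf (Q b) = δ ∧ l = H a ∩ H b}

/-- A row of the classification table, for a class `S` of Veldkamp lines: every line in `S` is
incident with exactly `c` hyperplanes of type `C`, `h₀` of type `H` with Arf invariant `0`,
`h₁` of type `H` with Arf invariant `1`, and with `c + h₀ + h₁` hyperplanes in all;
it has `size` points; and `S` consists of `copies` lines. -/
def TableRow (n : ℕ) (S : Set (Set (V n))) (c h₀ h₁ : ℕ) (size copies : ℚ) : Prop :=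
  (∀ l ∈ S,
    ((geometry n).incidentHyperplanes l ∩ cHyperplanes n).ncard = c ∧
    ((geometry n).incidentHyperplanes l ∩ hHyperplanes n 0).ncard = h₀ ∧
    ((geometry n).incidentHyperplanes l ∩ hHyperplanes n 1).ncard = h₁ ∧
    ((geometry n).incidentHyperplanes l).ncard = c + h₀ + h₁ ∧
    (l.ncard : ℚ) = size) ∧
  (S.ncard : ℚ) = copies

end QubitGeometry

namespace QubitGeometry

variable {n : ℕ}

/-! ### The symplectic form and the quadratic forms -/

/-! Geometric hyperplanes are the zero sets of the nonzero forms `form w`, with `w = (γ, p)` in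
`ZMod 2 × V n`. The hyperplane condition says that the indicator of the complement (with value 0 at
the zero vector) is additive on orthogonal pairs, and such functions are exactly the forms `γ Q₀ +
⟨p, ·⟩` (`exists_eq_form`). The cases `γ = 0` and `γ = 1` are the types C and H.

The forms are a vector space of dimension `2n + 1` over `ZMod 2`. Exponential sums show that three
independent forms take all triples of values (`exists_form_eq₃`), so a zero set contains `zeros u ∩
zeros v` only if its form is `u`, `v` or `u + v`. Hence the Veldkamp space is the projective space
of this vector space. Its lines have three points, and their types follow from the first coordinates
and the Arf invariants. The same sums give the sizes.

Two points of type H sum to one of type C, so every line is `C ∩ C` or `H ∩ H`. Transvections make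
`Sp n` transitive on pairs of vectors with given product and on pairs of forms `Q_a` with given Arf
invariants, which yields the five orbits. They are counted through ordered pairs, and their
cardinalities tell them apart. -/

lemma symp_add_left (x y z : V n) : symp (x + y) z = symp x z + symp y z := by
  simp only [symp, ← Finset.sum_add_distrib]
  exact Finset.sum_congr rfl fun i _ => by simp only [Pi.add_apply, Prod.fst_add, Prod.snd_add]; ring

lemma symp_comm (x y : V n) : symp x y = symp y x := by
  exact Finset.sum_congr rfl fun i _ => by ring

lemma symp_add_right (x y z : V n) : symp x (y + z) = symp x y + symp x z := by
  rw [symp_comm, symp_add_left, symp_comm y, symp_comm z]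

@[simp] lemma symp_self (x : V n) : symp x x = 0 :=
  Finset.sum_eq_zero fun i _ => by rw [mul_comm (x i).2]; exact CharTwo.add_self_eq_zero _

@[simp] lemma symp_zero_left (x : V n) : symp 0 x = 0 := by simp [symp]

@[simp] lemma symp_zero_right (x : V n) : symp x 0 = 0 := by simp [symp]

lemma symp_smul_left (t : ZMod 2) (x y : V n) : symp (t • x) y = t * symp x y := by
  simp only [symp, Finset.mul_sum]
  exact Finset.sum_congr rfl fun i _ => by simp; ring

lemma symp_smul_right (t : ZMod 2) (x y : V n) : symp x (t • y) = t * symp x y := by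
  rw [symp_comm, symp_smul_left, symp_comm]

@[simp] lemma Q₀_zero : Q₀ (0 : V n) = 0 := by simp [Q₀]

lemma Q₀_add (x y : V n) : Q₀ (x + y) = Q₀ x + Q₀ y + symp x y := by
  simp only [Q₀, symp, ← Finset.sum_add_distrib]
  exact Finset.sum_congr rfl fun i _ => by simp only [Pi.add_apply, Prod.fst_add, Prod.snd_add]; ring

lemma Q₀_smul (t : ZMod 2) (x : V n) : Q₀ (t • x) = t * Q₀ x := by
  have ht : t * t = t := by revert t; decide
  simp only [Q₀, Finset.mul_sum]
  refine Finset.sum_congr rfl fun i _ => ?_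
  simp only [Pi.smul_apply, Prod.smul_fst, Prod.smul_snd, smul_eq_mul]
  linear_combination (x i).1 * (x i).2 * ht

lemma add_self_eq_zero' {M : Type*} [AddCommGroup M] [Module (ZMod 2) M] (x : M) : x + x = 0 := by
  rw [← two_smul (ZMod 2) x, show (2 : ZMod 2) = 0 from rfl, zero_smul]

lemma add_eq_zero_iff_eq' {M : Type*} [AddCommGroup M] [Module (ZMod 2) M] {x y : M} :
    x + y = 0 ↔ x = y :=
  ⟨fun h => add_right_cancel (h.trans (add_self_eq_zero' y).symm), fun h => h ▸ add_self_eq_zero' x⟩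

lemma add_add_cancel' {M : Type*} [AddCommGroup M] [Module (ZMod 2) M] (x y : M) :
    x + (x + y) = y := by
  rw [← add_assoc, add_self_eq_zero', zero_add]

lemma ZMod_two_cases (t : ZMod 2) : t = 0 ∨ t = 1 := by revert t; decide

/-- The function `γ Q₀ + ⟨p, ·⟩` with coefficients `w = (γ, p)`. -/
def form (w : ZMod 2 × V n) (x : V n) : ZMod 2 := w.1 * Q₀ x + symp w.2 x

/-- The nonzero vectors at which `form w` vanishes. -/
def zeros (w : ZMod 2 × V n) : Set (V n) := {x | x ≠ 0 ∧ form w x = 0}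

lemma C_eq_zeros (p : V n) : C p = zeros (0, p) := by simp [C, zeros, form]

lemma H_eq_zeros (p : V n) : H p = zeros (1, p) := by simp [H, zeros, form, Q]

@[simp] lemma form_zero_right (w : ZMod 2 × V n) : form w 0 = 0 := by simp [form]

@[simp] lemma form_zero_left (x : V n) : form 0 x = 0 := by simp [form]

lemma form_add_left (u v : ZMod 2 × V n) (x : V n) : form (u + v) x = form u x + form v x := by
  simp only [form, Prod.fst_add, Prod.snd_add, symp_add_left]; ring

lemma form_add_right (w : ZMod 2 × V n) (x y : V n) :
    form w (x + y) = form w x + form w y + w.1 * symp x y := by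
  simp only [form, symp_add_right, Q₀_add]; ring

/-! ### Exponential sums -/

/-- The nontrivial character of `ZMod 2`. -/
def sgn (t : ZMod 2) : ℤ := if t = 0 then 1 else -1

@[simp] lemma sgn_zero : sgn 0 = 1 := rfl

@[simp] lemma sgn_one : sgn 1 = -1 := rfl

lemma sgn_add (s t : ZMod 2) : sgn (s + t) = sgn s * sgn t := by revert s t; decide

lemma sgn_sum {ι : Type*} (s : Finset ι) (f : ι → ZMod 2) :
    sgn (∑ i ∈ s, f i) = ∏ i ∈ s, sgn (f i) := by
  classical
  induction s using Finset.induction_on with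
  | empty => simp
  | insert a s ha ih => rw [Finset.sum_insert ha, Finset.prod_insert ha, sgn_add, ih]

/-- The exponential sum of `form w`. -/
def expSum (w : ZMod 2 × V n) : ℤ := ∑ x : V n, sgn (form w x)

/-- The form is a sum of functions of single coordinates, so its character sum factors. -/
lemma expSum_eq_prod (w : ZMod 2 × V n) :
    expSum w = ∏ i, ∑ z : ZMod 2 × ZMod 2,
      sgn (w.1 * (z.1 * z.2) + ((w.2 i).1 * z.2 + (w.2 i).2 * z.1)) := by
  rw [Finset.prod_univ_sum, expSum, Fintype.piFinset_univ]
  refine Finset.sum_congr rfl fun x _ => ?_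
  rw [← sgn_sum, form, Q₀, symp, Finset.mul_sum, ← Finset.sum_add_distrib]

lemma expSum_zero : expSum (0 : ZMod 2 × V n) = 4 ^ n := by
  simp only [expSum, form_zero_left, sgn_zero, Finset.sum_const, Finset.card_univ]
  simp

lemma expSum_linear {p : V n} (hp : p ≠ 0) : expSum (0, p) = 0 := by
  obtain ⟨i, hi⟩ := Function.ne_iff.mp hp
  rw [expSum_eq_prod]
  refine Finset.prod_eq_zero (Finset.mem_univ i) ?_
  have key : ∀ q : ZMod 2 × ZMod 2, q ≠ 0 → ∑ z : ZMod 2 × ZMod 2,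
      sgn ((0 : ZMod 2) * (z.1 * z.2) + (q.1 * z.2 + q.2 * z.1)) = 0 := by decide
  exact key _ hi

lemma expSum_quadratic (p : V n) : expSum (1, p) = sgn (Q₀ p) * 2 ^ n := by
  have key : ∀ q : ZMod 2 × ZMod 2, ∑ z : ZMod 2 × ZMod 2,
      sgn ((1 : ZMod 2) * (z.1 * z.2) + (q.1 * z.2 + q.2 * z.1)) = sgn (q.1 * q.2) * 2 := by decide
  rw [expSum_eq_prod, Finset.prod_congr rfl fun i _ => key (p i), Finset.prod_mul_distrib, Q₀,
    sgn_sum]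
  simp

/-- The common error bound for the counts below: linear forms contribute nothing, quadratic ones at
most the square root of `4 ^ n`. -/
lemma abs_sgn_mul_expSum_le {w : ZMod 2 × V n} (hw : w ≠ 0) (t : ZMod 2) :
    |sgn t * expSum w| ≤ if w.1 = 0 then 0 else 2 ^ n := by
  have hs : ∀ t, |sgn t| = 1 := by decide
  obtain ⟨γ, p⟩ := w
  rcases ZMod_two_cases γ with rfl | rfl
  · have hp : p ≠ 0 := fun h => hw (by rw [h]; rfl)
    simp [expSum_linear hp]
  · simp [expSum_quadratic, abs_mul, hs]

lemma one_add_sgn (s t : ZMod 2) : 1 + sgn s * sgn t = if t = s then 2 else 0 := by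
  revert s t; decide

/-- The indicator of `t = α` is `(1 + sgn α * sgn t) / 2`. Products of such indicators give the
versions for two and three forms. -/
lemma two_mul_card_form_eq (u : ZMod 2 × V n) (α : ZMod 2) :
    2 * ((Finset.univ.filter fun x : V n => form u x = α).card : ℤ) =
      expSum (0 : ZMod 2 × V n) + sgn α * expSum u := by
  rw [Finset.card_filter]
  simp only [expSum, Finset.mul_sum, ← Finset.sum_add_distrib, form_zero_left, sgn_zero,
    one_add_sgn]
  push_cast
  rw [Finset.mul_sum]
  exact Finset.sum_congr rfl fun x _ => by split_ifs <;> rfl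

lemma four_mul_card_form_eq (u v : ZMod 2 × V n) (α β : ZMod 2) :
    4 * ((Finset.univ.filter fun x : V n => form u x = α ∧ form v x = β).card : ℤ) =
      expSum (0 : ZMod 2 × V n) + sgn α * expSum u + sgn β * expSum v
        + sgn (α + β) * expSum (u + v) := by
  rw [Finset.card_filter]
  simp only [expSum, Finset.mul_sum, ← Finset.sum_add_distrib, form_zero_left, sgn_zero]
  push_cast
  rw [Finset.mul_sum]
  refine Finset.sum_congr rfl fun x _ => ?_
  have : ∀ α β s t : ZMod 2, (4 : ℤ) * (if s = α ∧ t = β then 1 else 0) =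
    1 + sgn α * sgn s + sgn β * sgn t + sgn (α + β) * sgn (s + t) := by decide
  rw [form_add_left, this]

lemma eight_mul_card_form_eq (u v w : ZMod 2 × V n) (α β γ : ZMod 2) :
    8 * ((Finset.univ.filter
        fun x : V n => form u x = α ∧ form v x = β ∧ form w x = γ).card : ℤ) =
      expSum (0 : ZMod 2 × V n) + sgn α * expSum u + sgn β * expSum v + sgn γ * expSum w
        + sgn (α + β) * expSum (u + v) + sgn (α + γ) * expSum (u + w)
        + sgn (β + γ) * expSum (v + w) + sgn (α + β + γ) * expSum (u + v + w) := by
  rw [Finset.card_filter]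
  simp only [expSum, Finset.mul_sum, ← Finset.sum_add_distrib, form_zero_left, sgn_zero]
  push_cast
  rw [Finset.mul_sum]
  refine Finset.sum_congr rfl fun x _ => ?_
  have : ∀ α β γ r s t : ZMod 2, (8 : ℤ) * (if r = α ∧ s = β ∧ t = γ then 1 else 0) =
    1 + sgn α * sgn r + sgn β * sgn s + sgn γ * sgn t + sgn (α + β) * sgn (r + s)
      + sgn (α + γ) * sgn (r + t) + sgn (β + γ) * sgn (s + t)
      + sgn (α + β + γ) * sgn (r + s + t) := by decide
  rw [form_add_left, form_add_left, form_add_left, form_add_left, form_add_left, this]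

/-! ### Values of independent forms, and containments between zero sets -/

lemma four_lt_two_pow (hn : 3 ≤ n) : (4 : ℤ) < 2 ^ n :=
  lt_of_lt_of_le (by norm_num) (pow_le_pow_right₀ (by norm_num : (1 : ℤ) ≤ 2) hn)

lemma four_pow_eq (n : ℕ) : (4 : ℤ) ^ n = 2 ^ n * 2 ^ n := by
  rw [← mul_pow]; norm_num

/-- Two independent forms take every pair of values. -/
lemma exists_form_eq₂ (hn : 3 ≤ n) {u v : ZMod 2 × V n} (hu : u ≠ 0) (hv : v ≠ 0) (huv : u ≠ v)
    (α β : ZMod 2) : ∃ x, form u x = α ∧ form v x = β := by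
  have h := four_mul_card_form_eq u v α β
  have h1 := abs_le.mp (abs_sgn_mul_expSum_le hu α)
  have h2 := abs_le.mp (abs_sgn_mul_expSum_le hv β)
  have h3 := abs_le.mp (abs_sgn_mul_expSum_le (mt add_eq_zero_iff_eq'.mp huv) (α + β))
  have hpos : (0 : ℤ) < (Finset.univ.filter fun x : V n => form u x = α ∧ form v x = β).card := by
    rw [expSum_zero, four_pow_eq] at h
    have h4 := four_lt_two_pow hn
    have h5 : (2 : ℤ) ^ n * 2 ^ n > 4 * 2 ^ n := by nlinarith
    -- At most two of `u`, `v`, `u + v` are quadratic, so the error is at most `2 * 2 ^ n`.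
    rcases ZMod_two_cases u.1 with a | a <;> rcases ZMod_two_cases v.1 with b | b <;>
      simp only [Prod.fst_add, a, b, if_true, one_ne_zero, if_false, add_zero, zero_add,
        CharTwo.add_self_eq_zero] at h1 h2 h3 <;> linarith
  obtain ⟨x, hx⟩ := Finset.card_pos.mp (by exact_mod_cast hpos)
  exact ⟨x, by simpa using hx⟩

/-- Three independent forms take every triple of values. -/
lemma exists_form_eq₃ (hn : 3 ≤ n) {u v w : ZMod 2 × V n} (hu : u ≠ 0) (hv : v ≠ 0) (huv : u ≠ v)
    (hw : w ≠ 0) (huw : u ≠ w) (hvw : v ≠ w) (h : u + v ≠ w) (α β γ : ZMod 2) :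
    ∃ x, form u x = α ∧ form v x = β ∧ form w x = γ := by
  have h0 := eight_mul_card_form_eq u v w α β γ
  have h1 := abs_le.mp (abs_sgn_mul_expSum_le hu α)
  have h2 := abs_le.mp (abs_sgn_mul_expSum_le hv β)
  have h3 := abs_le.mp (abs_sgn_mul_expSum_le hw γ)
  have h4 := abs_le.mp (abs_sgn_mul_expSum_le (mt add_eq_zero_iff_eq'.mp huv) (α + β))
  have h5 := abs_le.mp (abs_sgn_mul_expSum_le (mt add_eq_zero_iff_eq'.mp huw) (α + γ))
  have h6 := abs_le.mp (abs_sgn_mul_expSum_le (mt add_eq_zero_iff_eq'.mp hvw) (β + γ))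
  have h7 := abs_le.mp (abs_sgn_mul_expSum_le (mt add_eq_zero_iff_eq'.mp h) (α + β + γ))
  have hpos : (0 : ℤ) < (Finset.univ.filter
      fun x : V n => form u x = α ∧ form v x = β ∧ form w x = γ).card := by
    rw [expSum_zero, four_pow_eq] at h0
    have h8 := four_lt_two_pow hn
    have h9 : (2 : ℤ) ^ n * 2 ^ n > 4 * 2 ^ n := by nlinarith
    -- At most four of the seven nonzero combinations are quadratic, so `2 ^ n > 4` makes the main
    -- term `4 ^ n` win. This is where `3 ≤ n` is needed.
    rcases ZMod_two_cases u.1 with a | a <;> rcases ZMod_two_cases v.1 with b | b <;>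
      rcases ZMod_two_cases w.1 with c | c <;>
      simp only [Prod.fst_add, a, b, c, if_true, one_ne_zero, if_false, add_zero, zero_add,
        CharTwo.add_self_eq_zero] at h1 h2 h3 h4 h5 h6 h7 <;> linarith
  obtain ⟨x, hx⟩ := Finset.card_pos.mp (by exact_mod_cast hpos)
  exact ⟨x, by simpa using hx⟩

lemma exists_form_eq_one (hn : 3 ≤ n) {w : ZMod 2 × V n} (hw : w ≠ 0) : ∃ x, form w x = 1 := by
  by_contra! h
  have h0 := two_mul_card_form_eq w 1
  rw [Finset.filter_false_of_mem fun x _ => h x, expSum_zero, four_pow_eq] at h0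
  have h1 := abs_le.mp (abs_sgn_mul_expSum_le hw 1)
  have h2 := four_lt_two_pow hn
  have : (2 : ℤ) ^ n * 2 ^ n > 4 * 2 ^ n := by nlinarith
  rw [Finset.card_empty] at h0
  push_cast at h0
  split_ifs at h1 <;> linarith

lemma ne_zero_of_form_eq_one {w : ZMod 2 × V n} {x : V n} (h : form w x = 1) : x ≠ 0 := by
  rintro rfl
  simp at h

/-- Containment of zero sets is linear dependence. -/
lemma eq_of_zeros_subset (hn : 3 ≤ n) {u w : ZMod 2 × V n} (hu : u ≠ 0) (hw : w ≠ 0)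
    (h : zeros u ⊆ zeros w) : u = w := by
  by_contra huw
  obtain ⟨x, hx, hx'⟩ := exists_form_eq₂ hn hu hw huw 0 1
  have := (h ⟨ne_zero_of_form_eq_one hx', hx⟩).2
  simp [this] at hx'

/-- If `w` were independent of `u` and `v`, some vector would give them the values 0, 0, 1; the
value 1 also ensures that this vector is nonzero. -/
lemma mem_of_zeros_inter_subset (hn : 3 ≤ n) {u v w : ZMod 2 × V n} (hu : u ≠ 0) (hv : v ≠ 0)
    (huv : u ≠ v) (hw : w ≠ 0) (h : zeros u ∩ zeros v ⊆ zeros w) :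
    w = u ∨ w = v ∨ w = u + v := by
  by_contra! hc
  obtain ⟨x, hx, hx', hx''⟩ :=
    exists_form_eq₃ hn hu hv huv hw hc.1.symm hc.2.1.symm hc.2.2.symm 0 0 1
  have h0 := ne_zero_of_form_eq_one hx''
  have := (h ⟨⟨h0, hx⟩, ⟨h0, hx'⟩⟩).2
  simp [this] at hx''

lemma zeros_inter_eq (u v : ZMod 2 × V n) : zeros u ∩ zeros v = zeros u ∩ zeros (u + v) := by
  ext x
  simp only [zeros, Set.mem_inter_iff, Set.mem_ofPred_eq, form_add_left]
  constructor <;> rintro ⟨⟨h, h1⟩, -, h2⟩ <;> simp_all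

/-- The sign of the exponential sum, `sgn (Q₀ p)`, decides which value is the more frequent. -/
lemma arf_Q (p : V n) : arf (Q p) = Q₀ p := by
  have hQ : Q p = form (1, p) := by funext x; simp [Q, form]
  have h0 := two_mul_card_form_eq (1, p) 0
  have h1 := two_mul_card_form_eq (1, p) 1
  have hpos : (0 : ℤ) < 2 ^ n := by positivity
  rw [expSum_quadratic] at h0 h1
  have hc : ∀ ε, {x | form (1, p) x = ε}.ncard
      = (Finset.univ.filter fun x : V n => form (1, p) x = ε).card := fun ε => by
    rw [← Set.ncard_coe_finset]; simp
  rw [arf, hQ, hc, hc]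
  rcases ZMod_two_cases (Q₀ p) with h | h <;> rw [h] at h0 h1 ⊢ <;> simp only [sgn_zero, sgn_one] at h0 h1
  · rw [if_neg]; rw [not_lt]; zify; linarith
  · rw [if_pos]; zify; linarith

/-! ### The geometric hyperplanes -/

lemma symp_single (i : Fin n) (z : ZMod 2 × ZMod 2) (x : V n) :
    symp (Pi.single i z) x = z.1 * (x i).2 + z.2 * (x i).1 := by
  rw [symp, Finset.sum_eq_single i]
  · simp
  · intro j _ hj
    simp [hj]
  · simp

/-- Vectors with disjoint supports are orthogonal, so `f` splits along the coordinates. -/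
lemma apply_eq_sum_single {f : V n → ZMod 2} (hf : ∀ x y, symp x y = 0 → f (x + y) = f x + f y)
    (x : V n) : f x = ∑ i, f (Pi.single i (x i)) := by
  have hf0 : f 0 = 0 := by simpa using hf 0 0 (by simp)
  have key : ∀ s : Finset (Fin n),
      f (∑ i ∈ s, Pi.single i (x i)) = ∑ i ∈ s, f (Pi.single i (x i)) := by
    intro s
    induction s using Finset.induction_on with
    | empty => simpa using hf0
    | insert i s hi ih =>
      rw [Finset.sum_insert hi, Finset.sum_insert hi, hf, ih]
      have h0 : (∑ j ∈ s, Pi.single j (x j) : V n) i = 0 := by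
        rw [Finset.sum_apply]
        exact Finset.sum_eq_zero fun j hj =>
          Pi.single_eq_of_ne (fun h : i = j => hi (by rwa [h])) _
      rw [symp_single, h0]
      simp
  rw [← key, Finset.univ_sum_single]

/-- A function that is additive on orthogonal pairs is one of the forms. -/
lemma exists_eq_form (hn : 3 ≤ n) {f : V n → ZMod 2}
    (hf : ∀ x y, symp x y = 0 → f (x + y) = f x + f y) : ∃ w, ∀ x, f x = form w x := by
  have hf0 : f 0 = 0 := by simpa using hf 0 0 (by simp)
  -- On a single coordinate, any function vanishing at 0 is a multiple of `ab` plus a linear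
  -- function. It remains to see that the coefficient of `ab` does not depend on the coordinate.
  have hplane : ∀ (h : ZMod 2 × ZMod 2 → ZMod 2), h 0 = 0 → ∀ z, h z =
      (h (1, 1) + h (1, 0) + h (0, 1)) * (z.1 * z.2) + (h (0, 1) * z.2 + h (1, 0) * z.1) := by
    decide
  let F : Fin n → ZMod 2 × ZMod 2 → ZMod 2 := fun i z => f (Pi.single i z)
  let γ : Fin n → ZMod 2 := fun i => F i (1, 1) + F i (1, 0) + F i (0, 1)
  have hγ : ∀ i j, γ i = γ j := by
    intro i j
    by_cases hij : i = j
    · rw [hij]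
    have hsplit : ∀ z z', f (Pi.single i z + Pi.single j z') = F i z + F j z' := fun z z' => by
      refine hf _ _ ?_
      rw [symp_single, Pi.single_eq_of_ne hij]
      simp
    -- Each of the coordinates `i` and `j` contributes 1 to the product of these two vectors, so
    -- they are orthogonal. Additivity on them compares `γ i` with `γ j`.
    have h := hf (Pi.single i (1, 0) + Pi.single j (1, 0)) (Pi.single i (0, 1) + Pi.single j (0, 1))
      (by simp only [symp_add_left, symp_single, Pi.add_apply, Pi.single_eq_same,
            Pi.single_eq_of_ne hij, Pi.single_eq_of_ne (Ne.symm hij)]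
          decide)
    have hx : (Pi.single i (1, 0) + Pi.single j (1, 0) + (Pi.single i (0, 1) + Pi.single j (0, 1)) :
        V n) = Pi.single i (1, 1) + Pi.single j (1, 1) := by
      rw [add_add_add_comm, ← Pi.single_add, ← Pi.single_add]
      rfl
    rw [hx, hsplit, hsplit, hsplit] at h
    have aux : ∀ a b c d e g : ZMod 2, a + d = (b + e) + (c + g) → a + b + c = d + e + g := by
      decide
    exact aux _ _ _ _ _ _ h
  let i₀ : Fin n := ⟨0, by omega⟩
  refine ⟨(γ i₀, fun i => (F i (0, 1), F i (1, 0))), fun x => ?_⟩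
  rw [apply_eq_sum_single hf, form, Q₀, symp, Finset.mul_sum, ← Finset.sum_add_distrib]
  refine Finset.sum_congr rfl fun i _ => ?_
  rw [hγ i₀ i]
  exact hplane (F i) (by simpa [F] using hf0) (x i)

/-- On a line the form is additive, so its three values sum to 0: either all vanish or exactly one
does. -/
lemma isGeometricHyperplane_zeros (hn : 3 ≤ n) {w : ZMod 2 × V n} (hw : w ≠ 0) :
    (geometry n).IsGeometricHyperplane (zeros w) := by
  refine ⟨fun x hx => hx.1, ?_, ?_⟩
  · rintro l ⟨a, b, ha, hb, hab, hs, rfl⟩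
    have hadd : form w (a + b) = form w a + form w b := by rw [form_add_right, hs]; simp
    have hab0 : a + b ≠ 0 := mt add_eq_zero_iff_eq'.mp hab
    rcases ZMod_two_cases (form w a) with h1 | h1 <;>
      rcases ZMod_two_cases (form w b) with h2 | h2 <;> rw [h1, h2] at hadd
    · right
      rintro x (rfl | rfl | rfl)
      exacts [⟨ha, h1⟩, ⟨hb, h2⟩, ⟨hab0, by simpa using hadd⟩]
    all_goals
      left
      rw [Set.ncard_eq_one]
    · refine ⟨a, Set.eq_singleton_iff_unique_mem.mpr ⟨⟨⟨ha, h1⟩, by simp⟩, ?_⟩⟩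
      rintro x ⟨⟨-, hx⟩, (rfl | rfl | rfl)⟩ <;> simp_all
    · refine ⟨b, Set.eq_singleton_iff_unique_mem.mpr ⟨⟨⟨hb, h2⟩, by simp⟩, ?_⟩⟩
      rintro x ⟨⟨-, hx⟩, (rfl | rfl | rfl)⟩ <;> simp_all
    · refine ⟨a + b, Set.eq_singleton_iff_unique_mem.mpr ⟨⟨⟨hab0, hadd⟩, by simp⟩, ?_⟩⟩
      rintro x ⟨⟨-, hx⟩, (rfl | rfl | rfl)⟩ <;> simp_all
  · intro h
    obtain ⟨x, hx⟩ := exists_form_eq_one hn hw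
    have hmem : x ∈ zeros w := h ▸ ne_zero_of_form_eq_one hx
    exact zero_ne_one (hmem.2.symm.trans hx)

lemma exists_eq_zeros (hn : 3 ≤ n) {A : Set (V n)} (hA : (geometry n).IsGeometricHyperplane A) :
    ∃ w, w ≠ 0 ∧ A = zeros w := by
  classical
  obtain ⟨hsub, hline, hne⟩ := hA
  have h0A : (0 : V n) ∉ A := fun h => hsub h rfl
  let f : V n → ZMod 2 := fun x => if x = 0 ∨ x ∈ A then 0 else 1
  have hf : ∀ x y, symp x y = 0 → f (x + y) = f x + f y := by
    intro x y hxy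
    by_cases hx : x = 0
    · simp [hx, f]
    by_cases hy : y = 0
    · simp [hy, f]
    by_cases hne' : x = y
    · simp [hne', f, add_self_eq_zero']
    have hs : x + y ≠ 0 := mt add_eq_zero_iff_eq'.mp hne'
    simp only [f, hx, hy, hs, false_or]
    rcases hline _ ⟨x, y, hx, hy, hne', hxy, rfl⟩ with h | h
    · obtain ⟨c, hc⟩ := Set.ncard_eq_one.mp h
      have hmem : ∀ z, z ∈ A ∧ z ∈ ({x, y, x + y} : Set (V n)) ↔ z = c := fun z => by
        rw [← Set.mem_inter_iff, hc, Set.mem_singleton_iff]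
      have e1 : x ∈ A ↔ x = c := by simpa using hmem x
      have e2 : y ∈ A ↔ y = c := by simpa using hmem y
      have e3 : x + y ∈ A ↔ x + y = c := by simpa using hmem (x + y)
      have hx' : x + y ≠ x := fun h => hy (by simpa using h)
      have hy' : x + y ≠ y := fun h => hx (by simpa using h)
      simp only [e1, e2, e3]
      rcases ((hmem c).mpr rfl).2 with rfl | rfl | rfl
      · simp [hy, Ne.symm hne']
      · simp [hx, hne']
      · simp [hx, hy, CharTwo.add_self_eq_zero]
    · have e1 : x ∈ A := h (by simp)
      have e2 : y ∈ A := h (by simp)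
      have e3 : x + y ∈ A := h (by simp)
      simp [e1, e2, e3]
  obtain ⟨w, hw⟩ := exists_eq_form hn hf
  have hA : A = zeros w := by
    ext x
    by_cases hx : x = 0
    · simp [hx, h0A, zeros]
    · simp [zeros, ← hw, f, hx]
  refine ⟨w, ?_, hA⟩
  rintro rfl
  exact hne (hA.trans (by ext x; simp [zeros, geometry]))

lemma hasVeldkampPoints (hn : 3 ≤ n) : (geometry n).HasVeldkampPoints := by
  intro A B hA hB hAB
  obtain ⟨u, hu, rfl⟩ := exists_eq_zeros hn hA
  obtain ⟨v, hv, rfl⟩ := exists_eq_zeros hn hB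
  exact hAB.ne (by rw [eq_of_zeros_subset hn hu hv hAB.subset])

lemma hasVeldkampLines (hn : 3 ≤ n) : (geometry n).HasVeldkampLines := by
  intro A B D hA hB hD hAB hAD hBD h
  obtain ⟨u, hu, rfl⟩ := exists_eq_zeros hn hA
  obtain ⟨v, hv, rfl⟩ := exists_eq_zeros hn hB
  obtain ⟨w, hw, rfl⟩ := exists_eq_zeros hn hD
  rcases mem_of_zeros_inter_subset hn hu hv (fun e => hAB (by rw [e])) hw h with rfl | rfl | rfl
  · exact absurd rfl hAD
  · exact absurd rfl hBD
  · exact zeros_inter_eq u v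

/-! ### The action of the symplectic group -/

lemma symp_smul_smul (g : Sp n) (x y : V n) : symp (g • x) (g • y) = symp x y := g.2 x y

lemma Q₀_eq_of_expSum_eq {p q : V n} (h : expSum (1, p) = expSum (1, q)) : Q₀ p = Q₀ q := by
  rw [expSum_quadratic, expSum_quadratic] at h
  have hinj : Function.Injective sgn := by decide
  exact hinj (mul_right_cancel₀ (pow_ne_zero n two_ne_zero) h)

/-- Composing with `g` keeps additivity on orthogonal pairs, so the result is again a form.
Reindexing preserves the exponential sum, hence the Arf invariant. -/
lemma exists_form_smul (hn : 3 ≤ n) (g : Sp n) (w : ZMod 2 × V n) :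
    ∃ w', w'.1 = w.1 ∧ expSum w' = expSum w ∧ ∀ x, form w (g • x) = form w' x := by
  obtain ⟨w', hw'⟩ := exists_eq_form hn (f := fun x => form w (g • x)) fun x y h => by
    rw [smul_add, form_add_right, symp_smul_smul, h]; simp
  refine ⟨w', ?_, ?_, hw'⟩
  -- The failure of additivity on a pair with product 1 is the quadratic coefficient.
  · obtain ⟨p, hp⟩ : ∃ p : V n, p ≠ 0 :=
      ⟨Pi.single ⟨0, by omega⟩ (1, 1), by simp [Pi.single_eq_zero_iff]⟩
    obtain ⟨x, hx⟩ := exists_form_eq_one hn (w := (0, p)) fun h => hp (congrArg Prod.snd h)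
    have hpx : symp p x = 1 := by simpa [form] using hx
    have h1 := form_add_right w (g • p) (g • x)
    rw [← smul_add, symp_smul_smul, hw', hw', hw', form_add_right, hpx] at h1
    simpa using h1
  · rw [expSum, expSum, ← Equiv.sum_comp (MulAction.toPerm g) fun x => sgn (form w x)]
    exact Finset.sum_congr rfl fun x _ => by rw [← hw']; rfl

lemma inv_smul_zeros {g : Sp n} {w w' : ZMod 2 × V n} (h : ∀ x, form w (g • x) = form w' x) :
    g⁻¹ • zeros w = zeros w' := by
  ext x
  rw [Set.mem_inv_smul_set_iff]
  simp only [zeros, Set.mem_ofPred_eq, h, ne_eq, smul_eq_zero_iff_eq]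

lemma smul_C (g : Sp n) (p : V n) : g • C p = C (g • p) := by
  ext x
  rw [Set.mem_smul_set_iff_inv_smul_mem]
  simp only [C, Set.mem_ofPred_eq, ← symp_smul_smul g p, smul_inv_smul, ne_eq, smul_eq_zero_iff_eq]

/-- Since `g` need not preserve `Q₀`, the index `q` is in general not `g • p`; only its Arf
invariant is controlled. -/
lemma exists_smul_H (hn : 3 ≤ n) (g : Sp n) (p : V n) : ∃ q, Q₀ q = Q₀ p ∧ g • H p = H q := by
  obtain ⟨⟨γ, q⟩, h1, h2, h3⟩ := exists_form_smul hn g⁻¹ (1, p)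
  obtain rfl : γ = 1 := h1
  refine ⟨q, Q₀_eq_of_expSum_eq h2, ?_⟩
  rw [H_eq_zeros, H_eq_zeros, ← inv_smul_zeros h3, inv_inv]

/-- The symplectic transvection `x ↦ x + ⟨x, c⟩ c`. -/
def transvection (c : V n) : Sp n :=
  ⟨LinearEquiv.ofInvolutive
    { toFun := fun x => x + symp x c • c
      map_add' := fun x y => by rw [symp_add_left, add_smul]; abel
      map_smul' := fun t x => by rw [symp_smul_left, mul_smul, smul_add]; rfl }
    (fun x => by
      change x + symp x c • c + symp (x + symp x c • c) c • c = x
      rw [symp_add_left, symp_smul_left, symp_self, mul_zero, add_zero, add_assoc,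
        add_self_eq_zero', add_zero]),
   fun x y => by
      change symp (x + symp x c • c) (y + symp y c • c) = symp x y
      simp only [symp_add_left, symp_add_right, symp_smul_left, symp_smul_right, symp_self,
        symp_comm c y]
      linear_combination CharTwo.add_self_eq_zero (symp x c * symp y c)⟩

lemma transvection_smul (c x : V n) : transvection c • x = x + symp x c • c := rfl

lemma transvection_smul_of_eq_zero {c x : V n} (h : symp x c = 0) : transvection c • x = x := by
  simp [transvection_smul, h]

lemma transvection_add_smul {x y : V n} (h : symp x y = 1) : transvection (x + y) • x = y := by
  rw [transvection_smul, symp_add_right, h, symp_self, zero_add, one_smul, add_add_cancel']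

lemma form_transvection (w : ZMod 2 × V n) (c x : V n) :
    form w (transvection c • x) = form w x + (w.1 + form w c) * symp x c := by
  have hs : ∀ s : ZMod 2, s * s = s := by decide
  rw [transvection_smul, form_add_right, form, form, form, Q₀_smul, symp_smul_right,
    symp_smul_right, hs]
  ring

/-- For `w.1 = 1` these are the orthogonal transvections, along vectors where the quadratic form is
1. -/
lemma form_transvection_of_eq {w : ZMod 2 × V n} {c : V n} (h : form w c = w.1) (x : V n) :
    form w (transvection c • x) = form w x := by
  rw [form_transvection, h, CharTwo.add_self_eq_zero, zero_mul, add_zero]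

lemma form_quadratic_add (p q : V n) : form (1, p) (p + q) = Q₀ p + Q₀ q := by
  have h2 := CharTwo.add_self_eq_zero (symp p q)
  simp only [form, Q₀_add, symp_add_right, symp_self]
  linear_combination h2

/-- Equal Arf invariants make `Q_p` vanish at `p + q`, so the transvection adds `⟨p + q, x⟩`, which
is `Q_p x + Q_q x`. -/
lemma form_quadratic_transvection {p q : V n} (h : Q₀ p = Q₀ q) (x : V n) :
    form (1, p) (transvection (p + q) • x) = form (1, q) x := by
  have h2 := CharTwo.add_self_eq_zero (symp p x)
  rw [form_transvection, form_quadratic_add, h, CharTwo.add_self_eq_zero]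
  simp only [form, symp_comm x, symp_add_left]
  linear_combination h2

/-! ### Transitivity on pairs of vectors and of quadratic forms -/

lemma linear_ne_zero {p : V n} (h : p ≠ 0) : ((0, p) : ZMod 2 × V n) ≠ 0 :=
  fun e => h (congrArg Prod.snd e)

lemma quadratic_ne_zero {p : V n} : ((1, p) : ZMod 2 × V n) ≠ 0 :=
  fun e => one_ne_zero (congrArg Prod.fst e)

lemma exists_symp_eq₂ (hn : 3 ≤ n) {a b : V n} (ha : a ≠ 0) (hb : b ≠ 0) (hab : a ≠ b)
    (α β : ZMod 2) : ∃ x, symp a x = α ∧ symp b x = β := by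
  simpa [form] using exists_form_eq₂ hn (linear_ne_zero ha) (linear_ne_zero hb)
    (fun e => hab (congrArg Prod.snd e)) α β

lemma exists_symp_eq₃ (hn : 3 ≤ n) {a b c : V n} (ha : a ≠ 0) (hb : b ≠ 0) (hab : a ≠ b)
    (hc : c ≠ 0) (hac : a ≠ c) (hbc : b ≠ c) (h : a + b ≠ c) (α β γ : ZMod 2) :
    ∃ x, symp a x = α ∧ symp b x = β ∧ symp c x = γ := by
  simpa [form] using exists_form_eq₃ hn (linear_ne_zero ha) (linear_ne_zero hb)
    (fun e => hab (congrArg Prod.snd e)) (linear_ne_zero hc) (fun e => hac (congrArg Prod.snd e))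
    (fun e => hbc (congrArg Prod.snd e)) (fun e => h (congrArg Prod.snd e)) α β γ

/-- `Sp(2n, 2)` is transitive on nonzero vectors. -/
lemma exists_smul_eq (hn : 3 ≤ n) {a b : V n} (ha : a ≠ 0) (hb : b ≠ 0) : ∃ g : Sp n, g • a = b := by
  by_cases hab : a = b
  · exact ⟨1, by rw [one_smul, hab]⟩
  -- A vector `c` with product 1 with both `a` and `b` links them by two transvections.
  obtain ⟨c, h1, h2⟩ := exists_symp_eq₂ hn ha hb hab 1 1
  refine ⟨transvection (c + b) * transvection (a + c), ?_⟩
  rw [mul_smul, transvection_add_smul h1, transvection_add_smul (by rw [symp_comm, h2])]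

lemma exists_smul_eq_of_fixed_aux {a b c : V n} (h : symp a b = symp a c) (hbc : symp b c = 1) :
    ∃ g : Sp n, g • a = a ∧ g • b = c :=
  ⟨transvection (b + c), transvection_smul_of_eq_zero (by
    rw [symp_add_right, h, CharTwo.add_self_eq_zero]), transvection_add_smul hbc⟩

/-- The stabilizer of `a` is transitive on the vectors with given product with `a`. -/
lemma exists_smul_eq_of_fixed (hn : 3 ≤ n) {a b c : V n} (ha : a ≠ 0) (hb : b ≠ 0) (hab : a ≠ b)
    (hc : c ≠ 0) (hac : a ≠ c) (h : symp a b = symp a c) :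
    ∃ g : Sp n, g • a = a ∧ g • b = c := by
  by_cases hbc : b = c
  · exact ⟨1, by simp, by simp [hbc]⟩
  rcases ZMod_two_cases (symp b c) with h0 | h1
  swap
  · exact exists_smul_eq_of_fixed_aux h h1
  -- The same detour, with each step fixing `a`. If `c = a + b`, the three prescribed products are
  -- dependent, but compatible because `symp b c = 0` forces `symp a b = 0`.
  obtain ⟨x, h1, h2, h3⟩ : ∃ x, symp a x = symp a b ∧ symp b x = 1 ∧ symp c x = 1 := by
    by_cases hs : a + b = c
    · subst hs
      have hε : symp a b = 0 := by rw [symp_comm]; simpa [symp_add_right] using h0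
      obtain ⟨x, h1, h2⟩ := exists_symp_eq₂ hn ha hb hab 0 1
      exact ⟨x, by rw [h1, hε], h2, by rw [symp_add_left, h1, h2, zero_add]⟩
    · exact exists_symp_eq₃ hn ha hb hab hc hac hbc hs _ _ _
  obtain ⟨g, hg, hg'⟩ := exists_smul_eq_of_fixed_aux h1.symm h2
  obtain ⟨k, hk, hk'⟩ := exists_smul_eq_of_fixed_aux (h1.trans h) (by rw [symp_comm, h3])
  exact ⟨k * g, by rw [mul_smul, hg, hk], by rw [mul_smul, hg', hk']⟩

/-- `Sp(2n, 2)` is transitive on pairs of distinct nonzero vectors with given product. -/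
lemma exists_smul_eq_pair (hn : 3 ≤ n) {a b a' b' : V n} (ha : a ≠ 0) (hb : b ≠ 0) (hab : a ≠ b)
    (ha' : a' ≠ 0) (hb' : b' ≠ 0) (hab' : a' ≠ b') (h : symp a b = symp a' b') :
    ∃ g : Sp n, g • a = a' ∧ g • b = b' := by
  obtain ⟨g, rfl⟩ := exists_smul_eq hn ha ha'
  obtain ⟨k, hk, hk'⟩ := exists_smul_eq_of_fixed hn ha' (b := g • b)
    ((smul_ne_zero_iff_ne g).mpr hb) (by simpa using hab) hb' hab' (by rw [symp_smul_smul, h])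
  exact ⟨k * g, by rw [mul_smul, hk], by rw [mul_smul, hk']⟩

lemma exists_form_smul_eq_of_fixed_aux {a b c : V n} (h : Q₀ b = Q₀ c)
    (hbc : form (1, a) (b + c) = 1) :
    ∃ g : Sp n, (∀ x, form (1, a) (g • x) = form (1, a) x) ∧
      ∀ x, form (1, b) (g • x) = form (1, c) x :=
  ⟨transvection (b + c), form_transvection_of_eq hbc, form_quadratic_transvection h⟩

/-- The stabilizer of `Q_a` is transitive on the forms `Q_b ≠ Q_a` with given Arf invariant. -/
lemma exists_form_smul_eq_of_fixed (hn : 3 ≤ n) {a b c : V n} (hab : a ≠ b) (hac : a ≠ c)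
    (h : Q₀ b = Q₀ c) :
    ∃ g : Sp n, (∀ x, form (1, a) (g • x) = form (1, a) x) ∧
      ∀ x, form (1, b) (g • x) = form (1, c) x := by
  by_cases hbc : b = c
  · exact ⟨1, by simp, by simp [hbc]⟩
  -- The detour goes through `Q_{a+x}`. The first value gives it the Arf invariant of `Q_b`; the
  -- other two make `Q_a` equal to 1 at `b + (a + x)` and `c + (a + x)`, so both transvections
  -- preserve `Q_a`.
  obtain ⟨x, h1, h2, h3⟩ := exists_form_eq₃ hn (u := (1, a)) (v := (0, a + b)) (w := (0, a + c))
    quadratic_ne_zero (linear_ne_zero (mt add_eq_zero_iff_eq'.mp hab))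
    (fun e => one_ne_zero (congrArg Prod.fst e)) (linear_ne_zero (mt add_eq_zero_iff_eq'.mp hac))
    (fun e => one_ne_zero (congrArg Prod.fst e))
    (fun e => hbc (add_left_cancel (congrArg Prod.snd e)))
    (fun e => one_ne_zero ((add_zero (1 : ZMod 2)).symm.trans (congrArg Prod.fst e)))
    (Q₀ a + Q₀ b) 1 1
  have hQ : Q₀ (a + x) = Q₀ b := by
    have e := CharTwo.add_self_eq_zero (Q₀ a)
    simp only [form] at h1
    rw [Q₀_add]
    linear_combination h1 + e
  have hstep : ∀ d : V n, Q₀ d = Q₀ b → form (0, a + d) x = 1 → form (1, a) (d + (a + x)) = 1 := by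
    intro d hd hdx
    have e1 := CharTwo.add_self_eq_zero (Q₀ b)
    have e2 := CharTwo.add_self_eq_zero (symp a d)
    simp only [form, symp_add_left] at hdx
    simp only [form]
    rw [Q₀_add d, hd, hQ]
    simp only [symp_add_right, symp_self, symp_comm d a]
    linear_combination hdx + e1 + e2
  obtain ⟨g, hg, hg'⟩ := exists_form_smul_eq_of_fixed_aux hQ.symm (hstep b rfl h2)
  obtain ⟨k, hk, hk'⟩ := exists_form_smul_eq_of_fixed_aux (a := a) (hQ.trans h)
    (by rw [add_comm]; exact hstep c h.symm h3)
  -- Forms are pulled back, so the map used first stands on the left.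
  exact ⟨g * k, fun y => by rw [mul_smul, hg, hk], fun y => by rw [mul_smul, hg', hk']⟩

lemma form_injective (hn : 3 ≤ n) {u v : ZMod 2 × V n} (h : ∀ x, form u x = form v x) : u = v := by
  by_contra huv
  obtain ⟨x, hx⟩ := exists_form_eq_one hn (mt add_eq_zero_iff_eq'.mp huv)
  rw [form_add_left, h, CharTwo.add_self_eq_zero] at hx
  exact zero_ne_one hx

/-- `Sp(2n, 2)` is transitive on pairs of distinct forms `Q_a` with given Arf invariants. -/
lemma exists_form_smul_eq_pair (hn : 3 ≤ n) {a b a' b' : V n} (hab : a ≠ b) (hab' : a' ≠ b')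
    (ha : Q₀ a = Q₀ a') (hb : Q₀ b = Q₀ b') :
    ∃ g : Sp n, (∀ x, form (1, a) (g • x) = form (1, a') x) ∧
      ∀ x, form (1, b) (g • x) = form (1, b') x := by
  have hg := form_quadratic_transvection ha
  set g := transvection (a + a')
  obtain ⟨⟨γ, c⟩, h1, h2, h3⟩ := exists_form_smul hn g (1, b)
  obtain rfl : γ = 1 := h1
  have hne : a' ≠ c := by
    rintro rfl
    refine hab (congrArg Prod.snd (form_injective hn (u := (1, a)) (v := (1, b)) fun x => ?_))
    rw [← smul_inv_smul g x, hg, h3]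
  obtain ⟨k, hk, hk'⟩ := exists_form_smul_eq_of_fixed hn hne hab' ((Q₀_eq_of_expSum_eq h2).trans hb)
  exact ⟨g * k, fun x => by rw [mul_smul, hg, hk], fun x => by rw [mul_smul, h3, hk']⟩

lemma mem_spOrbit_iff {l m : Set (V n)} : m ∈ spOrbit l ↔ ∃ g : Sp n, g • l = m := Iff.rfl

lemma spOrbit_ccLines (hn : 3 ≤ n) {ε : ZMod 2} {l : Set (V n)} (hl : l ∈ ccLines n ε) :
    spOrbit l = ccLines n ε := by
  obtain ⟨a, b, ha, hb, hab, hs, rfl⟩ := hl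
  ext m
  rw [mem_spOrbit_iff]
  constructor
  · rintro ⟨g, rfl⟩
    exact ⟨g • a, g • b, (smul_ne_zero_iff_ne g).mpr ha, (smul_ne_zero_iff_ne g).mpr hb,
      by simpa using hab,
      by rw [symp_smul_smul, hs], by rw [Set.smul_set_inter, smul_C, smul_C]⟩
  · rintro ⟨a', b', ha', hb', hab', hs', rfl⟩
    obtain ⟨g, rfl, rfl⟩ := exists_smul_eq_pair hn ha hb hab ha' hb' hab' (hs.trans hs'.symm)
    exact ⟨g, by rw [Set.smul_set_inter, smul_C, smul_C]⟩

lemma zeros_injOn (hn : 3 ≤ n) {u v : ZMod 2 × V n} (hu : u ≠ 0) (hv : v ≠ 0)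
    (h : zeros u = zeros v) : u = v :=
  eq_of_zeros_subset hn hu hv h.subset

lemma H_injective (hn : 3 ≤ n) : Function.Injective (H : V n → Set (V n)) := fun a b h =>
  congrArg Prod.snd (zeros_injOn hn (u := (1, a)) (v := (1, b)) quadratic_ne_zero quadratic_ne_zero
    (by rwa [← H_eq_zeros, ← H_eq_zeros]))

lemma spOrbit_hhLines (hn : 3 ≤ n) {ε δ : ZMod 2} {l : Set (V n)} (hl : l ∈ hhLines n ε δ) :
    spOrbit l = hhLines n ε δ := by
  obtain ⟨a, b, hab, ha, hb, rfl⟩ := hl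
  rw [arf_Q] at ha hb
  ext m
  rw [mem_spOrbit_iff]
  constructor
  · rintro ⟨g, rfl⟩
    obtain ⟨a', ha', hga⟩ := exists_smul_H hn g a
    obtain ⟨b', hb', hgb⟩ := exists_smul_H hn g b
    refine ⟨a', b', ?_, by rw [arf_Q, ha', ha], by rw [arf_Q, hb', hb],
      by rw [Set.smul_set_inter, hga, hgb]⟩
    rintro rfl
    exact hab (H_injective hn (MulAction.injective g (hga.trans hgb.symm)))
  · rintro ⟨a', b', hab', ha', hb', rfl⟩
    rw [arf_Q] at ha' hb'
    obtain ⟨g, hg, hg'⟩ := exists_form_smul_eq_pair hn hab hab' (ha.trans ha'.symm)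
      (hb.trans hb'.symm)
    refine ⟨g⁻¹, ?_⟩
    simp only [H_eq_zeros, Set.smul_set_inter, inv_smul_zeros hg, inv_smul_zeros hg']

/-! ### The hyperplanes incident with a Veldkamp line -/

open Classical in
-- The incident hyperplanes are the zero sets of the three nonzero combinations of `u` and `v`. The
-- predicate `P` lets one count serve every type.
lemma ncard_incidentHyperplanes_inter (hn : 3 ≤ n) (P : ZMod 2 × V n → Prop) {u v : ZMod 2 × V n}
    (hu : u ≠ 0) (hv : v ≠ 0) (huv : u ≠ v) :
    ((geometry n).incidentHyperplanes (zeros u ∩ zeros v) ∩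
      {A | ∃ w, w ≠ 0 ∧ P w ∧ A = zeros w}).ncard =
      (if P u then 1 else 0) + ((if P v then 1 else 0) + if P (u + v) then 1 else 0) := by
  have huv0 : u + v ≠ 0 := mt add_eq_zero_iff_eq'.mp huv
  have h0 : ∀ w ∈ ({u, v, u + v} : Finset (ZMod 2 × V n)), w ≠ 0 := by
    simp [hu, hv, huv0]
  have himage : (geometry n).incidentHyperplanes (zeros u ∩ zeros v) ∩
      {A | ∃ w, w ≠ 0 ∧ P w ∧ A = zeros w} =
      zeros '' (({u, v, u + v} : Finset (ZMod 2 × V n)).filter P) := by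
    ext A
    constructor
    · rintro ⟨⟨-, hA⟩, w, hw, hP, rfl⟩
      refine ⟨w, ?_, rfl⟩
      have := mem_of_zeros_inter_subset hn hu hv huv hw hA
      simpa using ⟨this, hP⟩
    · rintro ⟨w, hw, rfl⟩
      rw [Finset.mem_coe, Finset.mem_filter] at hw
      refine ⟨⟨isGeometricHyperplane_zeros hn (h0 w hw.1), ?_⟩, w, h0 w hw.1, hw.2, rfl⟩
      have := hw.1
      simp only [Finset.mem_insert, Finset.mem_singleton] at this
      rcases this with rfl | rfl | rfl
      · exact Set.inter_subset_left
      · exact Set.inter_subset_right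
      · rw [zeros_inter_eq]; exact Set.inter_subset_right
  rw [himage, Set.InjOn.ncard_image, Set.ncard_coe_finset, Finset.card_filter,
    Finset.sum_insert, Finset.sum_insert, Finset.sum_singleton]
  · simpa using hu
  · simp [huv, hv]
  · intro w hw w' hw' h
    rw [Finset.mem_coe, Finset.mem_filter] at hw hw'
    exact zeros_injOn hn (h0 w hw.1) (h0 w' hw'.1) h

lemma cHyperplanes_eq :
    cHyperplanes n = {A | ∃ w : ZMod 2 × V n, w ≠ 0 ∧ w.1 = 0 ∧ A = zeros w} := by
  ext A
  constructor
  · rintro ⟨p, hp, rfl⟩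
    exact ⟨(0, p), linear_ne_zero hp, rfl, C_eq_zeros p⟩
  · rintro ⟨⟨γ, p⟩, h0, h, rfl⟩
    obtain rfl : γ = 0 := h
    exact ⟨p, fun h => h0 (by rw [h]; rfl), (C_eq_zeros p).symm⟩

lemma hHyperplanes_eq (ε : ZMod 2) : hHyperplanes n ε =
    {A | ∃ w : ZMod 2 × V n, w ≠ 0 ∧ (w.1 = 1 ∧ Q₀ w.2 = ε) ∧ A = zeros w} := by
  ext A
  constructor
  · rintro ⟨p, hp, rfl⟩
    exact ⟨(1, p), quadratic_ne_zero, ⟨rfl, by rw [← hp, arf_Q]⟩, H_eq_zeros p⟩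
  · rintro ⟨⟨γ, p⟩, -, ⟨h, h'⟩, rfl⟩
    obtain rfl : γ = 1 := h
    exact ⟨p, by rw [arf_Q, ← h'], (H_eq_zeros p).symm⟩

lemma ncard_incidentHyperplanes (hn : 3 ≤ n) {u v : ZMod 2 × V n}
    (hu : u ≠ 0) (hv : v ≠ 0) (huv : u ≠ v) :
    ((geometry n).incidentHyperplanes (zeros u ∩ zeros v)).ncard = 3 := by
  have h := ncard_incidentHyperplanes_inter hn (fun _ => True) hu hv huv
  rw [Set.inter_eq_left.mpr] at h
  · simpa using h
  · intro A hA
    obtain ⟨w, hw, h⟩ := exists_eq_zeros hn hA.1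
    exact ⟨w, hw, trivial, h⟩

/-- The summand 4 on the left accounts for the zero vector, which is not a point. -/
lemma four_mul_ncard_zeros_inter (u v : ZMod 2 × V n) :
    4 * ((zeros u ∩ zeros v).ncard : ℤ) + 4 = 4 ^ n + expSum u + expSum v + expSum (u + v) := by
  classical
  have h := four_mul_card_form_eq u v 0 0
  have hset : zeros u ∩ zeros v =
      ((Finset.univ.filter fun x : V n => form u x = 0 ∧ form v x = 0).erase 0 : Finset (V n)) := by
    ext x
    simp only [zeros, Set.mem_inter_iff, Set.mem_ofPred_eq, Finset.coe_erase, Finset.coe_filter,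
      Finset.mem_univ, true_and, Set.mem_sdiff, Set.mem_singleton_iff]
    tauto
  have hcard := Finset.card_erase_add_one
    (s := Finset.univ.filter fun x : V n => form u x = 0 ∧ form v x = 0) (a := 0) (by simp)
  rw [hset, Set.ncard_coe_finset]
  rw [← hcard, expSum_zero] at h
  push_cast at h
  simp only [add_zero, sgn_zero, one_mul] at h
  linarith

/-! ### The number of Veldkamp lines in each class -/

lemma card_eq_mul_card_image {α β : Type*} [DecidableEq β] {s : Finset α} (f : α → β) {k : ℕ}
    (h : ∀ a ∈ s, (s.filter fun x => f x = f a).card = k) : s.card = k * (s.image f).card := by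
  rw [Finset.card_eq_sum_card_image f s, Finset.sum_congr rfl (g := fun _ => k), Finset.sum_const,
    smul_eq_mul, mul_comm]
  intro b hb
  obtain ⟨a, ha, rfl⟩ := Finset.mem_image.mp hb
  exact h a ha

/-- Any two of `a`, `b`, `a + b` define the same Veldkamp line and have the same product. -/
lemma C_inter_eq_iff (hn : 3 ≤ n) {a b c d : V n} (ha : a ≠ 0) (hb : b ≠ 0) (hab : a ≠ b)
    (hcd : c ≠ d) :
    c ≠ 0 ∧ d ≠ 0 ∧ symp c d = symp a b ∧ C c ∩ C d = C a ∩ C b ↔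
      (c = a ∨ c = b ∨ c = a + b) ∧ (d = a ∨ d = b ∨ d = a + b) := by
  have hs : a + b ≠ 0 := mt add_eq_zero_iff_eq'.mp hab
  constructor
  · rintro ⟨hc, hd, -, h⟩
    have key : ∀ e : V n, e ≠ 0 → C a ∩ C b ⊆ C e → e = a ∨ e = b ∨ e = a + b := by
      intro e he hsub
      rw [C_eq_zeros, C_eq_zeros, C_eq_zeros] at hsub
      simpa [Prod.ext_iff] using mem_of_zeros_inter_subset hn (linear_ne_zero ha)
        (linear_ne_zero hb) (fun e => hab (congrArg Prod.snd e)) (linear_ne_zero he) hsub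
    exact ⟨key c hc (h ▸ Set.inter_subset_left), key d hd (h ▸ Set.inter_subset_right)⟩
  · have e1 : C a ∩ C (a + b) = C a ∩ C b := by
      simpa only [C_eq_zeros, Prod.mk_add_mk, add_zero] using (zeros_inter_eq (0, a) (0, b)).symm
    have e2 : C b ∩ C (a + b) = C a ∩ C b := by
      simpa only [C_eq_zeros, Prod.mk_add_mk, add_zero, add_comm b a, Set.inter_comm (zeros (0, a))]
        using (zeros_inter_eq (0, b) (0, a)).symm
    rintro ⟨rfl | rfl | rfl, rfl | rfl | rfl⟩
    · exact absurd rfl hcd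
    · exact ⟨ha, hb, rfl, rfl⟩
    · exact ⟨ha, hs, by simp [symp_add_right], e1⟩
    · exact ⟨hb, ha, symp_comm _ _, Set.inter_comm _ _⟩
    · exact absurd rfl hcd
    · exact ⟨hb, hs, by simp [symp_add_right, symp_comm], e2⟩
    · exact ⟨hs, ha, by rw [symp_add_left, symp_self, zero_add, symp_comm], by rw [Set.inter_comm, e1]⟩
    · exact ⟨hs, hb, by simp [symp_add_left], by rw [Set.inter_comm, e2]⟩
    · exact absurd rfl hcd

/-- The ordered pairs of distinct nonzero vectors with product `ε`. -/
def pairs (n : ℕ) (ε : ZMod 2) : Finset (V n × V n) :=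
  Finset.univ.filter fun p => p.1 ≠ 0 ∧ p.2 ≠ 0 ∧ p.1 ≠ p.2 ∧ symp p.1 p.2 = ε

/-- Half of all vectors have product `ε` with `a`. For `ε = 0` these include 0 and `a`, which must
be discarded. -/
lemma two_mul_card_neighbours {a : V n} (ha : a ≠ 0) (ε : ZMod 2) :
    2 * ((Finset.univ.filter fun b : V n => b ≠ 0 ∧ a ≠ b ∧ symp a b = ε).card : ℤ) =
      4 ^ n - if ε = 0 then 4 else 0 := by
  have h := two_mul_card_form_eq (0, a) ε
  rw [expSum_zero, expSum_linear ha, mul_zero, add_zero] at h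
  simp only [form, zero_mul, zero_add] at h
  rcases ZMod_two_cases ε with rfl | rfl
  · have hset : (Finset.univ.filter fun b : V n => b ≠ 0 ∧ a ≠ b ∧ symp a b = 0) =
        ((Finset.univ.filter fun b : V n => symp a b = 0).erase 0).erase a := by
      ext b
      simp only [Finset.mem_filter, Finset.mem_erase, Finset.mem_univ, true_and, ne_comm (a := a)]
      tauto
    have h1 := Finset.card_erase_add_one
      (s := Finset.univ.filter fun b : V n => symp a b = 0) (a := 0) (by simp)
    have h2 := Finset.card_erase_add_one
      (s := (Finset.univ.filter fun b : V n => symp a b = 0).erase 0) (a := a) (by simp [ha])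
    rw [hset, if_pos rfl]
    rw [← h1, ← h2] at h
    push_cast at h
    linarith
  · rw [if_neg one_ne_zero, sub_zero, ← h]
    congr 3
    ext b
    simp only [Finset.mem_filter, Finset.mem_univ, true_and]
    refine ⟨fun h => h.2.2, fun h => ⟨?_, ?_, h⟩⟩ <;> rintro rfl <;> simp at h

lemma two_mul_card_pairs (n : ℕ) (ε : ZMod 2) :
    2 * ((pairs n ε).card : ℤ) = (4 ^ n - 1) * (4 ^ n - if ε = 0 then 4 else 0) := by
  have hfib : ∀ a : V n, ((pairs n ε).filter fun p => p.1 = a).card =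
      if a = 0 then 0 else
        (Finset.univ.filter fun b : V n => b ≠ 0 ∧ a ≠ b ∧ symp a b = ε).card := by
    intro a
    split_ifs with ha
    · rw [Finset.card_eq_zero, Finset.filter_eq_empty_iff]
      intro p hp h
      exact (Finset.mem_filter.mp hp).2.1 (h.trans ha)
    · refine Finset.card_bij' (fun p _ => p.2) (fun b _ => (a, b)) ?_ ?_ ?_ ?_
      · rintro ⟨a', b⟩ hp
        simp only [pairs, Finset.mem_filter, Finset.mem_univ, true_and] at hp ⊢
        obtain ⟨⟨-, h⟩, rfl⟩ := hp
        exact h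
      · intro b hb
        simp only [pairs, Finset.mem_filter, Finset.mem_univ, true_and] at hb ⊢
        exact ⟨⟨ha, hb⟩, trivial⟩
      · rintro ⟨a', b⟩ hp
        simp only [Finset.mem_filter] at hp
        rw [hp.2]
      · intro b _
        rfl
  have hcard : (Finset.univ.erase (0 : V n)).card + 1 = 4 ^ n := by
    rw [Finset.card_erase_add_one (Finset.mem_univ _), Finset.card_univ]
    simp
  rw [Finset.card_eq_sum_card_fiberwise (f := Prod.fst) (t := Finset.univ) (by simp),
    ← Finset.add_sum_erase _ _ (Finset.mem_univ (0 : V n)), hfib, if_pos rfl, zero_add]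
  push_cast
  rw [Finset.mul_sum, Finset.sum_congr rfl (g := fun _ => (4 ^ n - if ε = 0 then 4 else 0 : ℤ)),
    Finset.sum_const, nsmul_eq_mul]
  · zify at hcard
    rw [← hcard]
    ring
  · intro a ha
    rw [hfib, if_neg (Finset.ne_of_mem_erase ha), two_mul_card_neighbours (Finset.ne_of_mem_erase ha)]

lemma card_insert_insert_add {a b : V n} (ha : a ≠ 0) (hb : b ≠ 0) (hab : a ≠ b) :
    ({a, b, a + b} : Finset (V n)).card = 3 := by
  rw [Finset.card_eq_three]
  exact ⟨a, b, a + b, hab, by simpa using hb, by simpa using ha, rfl⟩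

/-- Each line arises from six ordered pairs; a further factor 2 comes from `two_mul_card_pairs`. -/
lemma twelve_mul_ncard_ccLines (hn : 3 ≤ n) (ε : ZMod 2) :
    12 * ((ccLines n ε).ncard : ℤ) = (4 ^ n - 1) * (4 ^ n - if ε = 0 then 4 else 0) := by
  classical
  have hset : ccLines n ε = (pairs n ε).image fun p => C p.1 ∩ C p.2 := by
    ext l
    simp only [ccLines, pairs, Finset.coe_image, Finset.coe_filter, Finset.mem_univ, true_and,
      Set.mem_image, Set.mem_ofPred_eq, Prod.exists]
    constructor
    · rintro ⟨a, b, h1, h2, h3, h4, rfl⟩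
      exact ⟨a, b, ⟨h1, h2, h3, h4⟩, rfl⟩
    · rintro ⟨a, b, ⟨h1, h2, h3, h4⟩, rfl⟩
      exact ⟨a, b, h1, h2, h3, h4, rfl⟩
  have hfib : ∀ p ∈ pairs n ε,
      ((pairs n ε).filter fun x => C x.1 ∩ C x.2 = C p.1 ∩ C p.2).card = 6 := by
    rintro ⟨a, b⟩ hab
    simp only [pairs, Finset.mem_filter, Finset.mem_univ, true_and] at hab
    obtain ⟨h1, h2, h3, h4⟩ := hab
    have : ((pairs n ε).filter fun x => C x.1 ∩ C x.2 = C a ∩ C b) =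
        ({a, b, a + b} : Finset (V n)).offDiag := by
      ext ⟨c, d⟩
      simp only [pairs, Finset.mem_filter, Finset.mem_univ, true_and, Finset.mem_offDiag,
        Finset.mem_insert, Finset.mem_singleton, ← h4]
      constructor
      · rintro ⟨⟨k1, k2, k3, k4⟩, k5⟩
        have := (C_inter_eq_iff hn h1 h2 h3 k3).mp ⟨k1, k2, k4, k5⟩
        exact ⟨this.1, this.2, k3⟩
      · rintro ⟨k1, k2, k3⟩
        obtain ⟨m1, m2, m3, m4⟩ := (C_inter_eq_iff hn h1 h2 h3 k3).mpr ⟨k1, k2⟩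
        exact ⟨⟨m1, m2, k3, m3⟩, m4⟩
    simp only [this, Finset.offDiag_card, card_insert_insert_add h1 h2 h3]
  have h6 := card_eq_mul_card_image _ hfib
  have h2 := two_mul_card_pairs n ε
  rw [h6] at h2
  rw [hset, Set.ncard_coe_finset, ← h2]
  push_cast
  ring

/-- The third hyperplane on the line has first coordinate `1 + 1 = 0`, so it is of type C. -/
lemma mem_of_H_inter_subset (hn : 3 ≤ n) {a b c : V n} (hab : a ≠ b) (h : H a ∩ H b ⊆ H c) :
    c = a ∨ c = b := by
  rw [H_eq_zeros, H_eq_zeros, H_eq_zeros] at h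
  rcases mem_of_zeros_inter_subset hn quadratic_ne_zero quadratic_ne_zero
    (fun e => hab (congrArg Prod.snd e)) quadratic_ne_zero h with h | h | h
  · exact Or.inl (congrArg Prod.snd h)
  · exact Or.inr (congrArg Prod.snd h)
  · exact absurd (congrArg Prod.fst h) (by simp [CharTwo.add_self_eq_zero])

/-- The vectors `p` for which `Q_p` has Arf invariant `ε`. -/
def arfVectors (n : ℕ) (ε : ZMod 2) : Finset (V n) := Finset.univ.filter fun p => Q₀ p = ε

lemma mem_arfVectors {ε : ZMod 2} {p : V n} : p ∈ arfVectors n ε ↔ Q₀ p = ε := by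
  simp [arfVectors]

lemma two_mul_card_arfVectors (n : ℕ) (ε : ZMod 2) :
    2 * ((arfVectors n ε).card : ℤ) = 4 ^ n + sgn ε * 2 ^ n := by
  have h := two_mul_card_form_eq ((1, 0) : ZMod 2 × V n) ε
  rw [expSum_zero, expSum_quadratic, Q₀_zero, sgn_zero, one_mul] at h
  simpa [form, arfVectors] using h

lemma two_mul_ncard_hhLines_self (hn : 3 ≤ n) (ε : ZMod 2) :
    2 * ((hhLines n ε ε).ncard : ℤ) =
      (arfVectors n ε).card * (arfVectors n ε).card - (arfVectors n ε).card := by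
  classical
  have hset : hhLines n ε ε = (arfVectors n ε).offDiag.image fun p => H p.1 ∩ H p.2 := by
    ext l
    simp only [hhLines, arf_Q, Finset.coe_image, Set.mem_image, Set.mem_ofPred_eq, Prod.exists,
      Finset.mem_coe, Finset.mem_offDiag, mem_arfVectors]
    constructor
    · rintro ⟨a, b, h1, h2, h3, rfl⟩
      exact ⟨a, b, ⟨h2, h3, h1⟩, rfl⟩
    · rintro ⟨a, b, ⟨h2, h3, h1⟩, rfl⟩
      exact ⟨a, b, h1, h2, h3, rfl⟩
  have hfib : ∀ p ∈ (arfVectors n ε).offDiag,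
      ((arfVectors n ε).offDiag.filter fun x => H x.1 ∩ H x.2 = H p.1 ∩ H p.2).card = 2 := by
    rintro ⟨a, b⟩ hab
    simp only [Finset.mem_offDiag, mem_arfVectors] at hab
    obtain ⟨h1, h2, h3⟩ := hab
    have : ((arfVectors n ε).offDiag.filter fun x => H x.1 ∩ H x.2 = H a ∩ H b) =
        ({a, b} : Finset (V n)).offDiag := by
      ext ⟨c, d⟩
      simp only [Finset.mem_filter, Finset.mem_offDiag, mem_arfVectors, Finset.mem_insert,
        Finset.mem_singleton]
      constructor
      · rintro ⟨⟨-, -, k3⟩, k4⟩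
        exact ⟨mem_of_H_inter_subset hn h3 (k4 ▸ Set.inter_subset_left),
          mem_of_H_inter_subset hn h3 (k4 ▸ Set.inter_subset_right), k3⟩
      · rintro ⟨rfl | rfl, rfl | rfl, k3⟩
        · exact absurd rfl k3
        · exact ⟨⟨h1, h2, k3⟩, rfl⟩
        · exact ⟨⟨h2, h1, k3⟩, Set.inter_comm _ _⟩
        · exact absurd rfl k3
    simp only [this, Finset.offDiag_card, Finset.card_pair h3]
  have h2 := card_eq_mul_card_image _ hfib
  rw [hset, Set.ncard_coe_finset]
  rw [Finset.offDiag_card] at h2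
  have hle := Nat.le_mul_self (arfVectors n ε).card
  zify [hle] at h2
  exact h2.symm

/-- The Arf invariants order the pair, so each line arises exactly once. -/
lemma ncard_hhLines_zero_one (hn : 3 ≤ n) :
    (hhLines n 0 1).ncard = (arfVectors n 0).card * (arfVectors n 1).card := by
  classical
  have hset : hhLines n 0 1 =
      (fun p : V n × V n => H p.1 ∩ H p.2) '' (arfVectors n 0 ×ˢ arfVectors n 1 : Finset _) := by
    ext l
    simp only [hhLines, arf_Q, Set.mem_image, Set.mem_ofPred_eq, Prod.exists,
      Finset.mem_coe, Finset.mem_product, mem_arfVectors]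
    constructor
    · rintro ⟨a, b, -, h2, h3, rfl⟩
      exact ⟨a, b, ⟨h2, h3⟩, rfl⟩
    · rintro ⟨a, b, ⟨h2, h3⟩, rfl⟩
      exact ⟨a, b, fun h => zero_ne_one (h2.symm.trans (h ▸ h3)), h2, h3, rfl⟩
  rw [hset, Set.InjOn.ncard_image, Set.ncard_coe_finset, Finset.card_product]
  rintro ⟨a, b⟩ hab ⟨c, d⟩ hcd h
  simp only [Finset.mem_coe, Finset.mem_product, mem_arfVectors] at hab hcd
  have hne : a ≠ b := by
    rintro rfl
    exact zero_ne_one (hab.1.symm.trans hab.2)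
  have h' : H a ∩ H b = H c ∩ H d := h
  have hc : H a ∩ H b ⊆ H c := h' ▸ Set.inter_subset_left
  have hd : H a ∩ H b ⊆ H d := h' ▸ Set.inter_subset_right
  rcases mem_of_H_inter_subset hn hne hc with rfl | rfl
  · rcases mem_of_H_inter_subset hn hne hd with rfl | rfl
    · exact absurd (hab.1.symm.trans hcd.2) zero_ne_one
    · rfl
  · exact absurd (hcd.1.symm.trans hab.2) zero_ne_one

/-! ### The classification table -/

/-- With `m = 2 ^ (n - 3)` all powers in the table become polynomials in `m`, free of truncated
subtraction. -/
lemma exists_pow_eq (hn : 3 ≤ n) : ∃ m : ℚ, 1 ≤ m ∧ (2 : ℚ) ^ (n - 3) = m ∧ (2 : ℚ) ^ (n - 1) = 4 * m ∧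
    (2 : ℚ) ^ n = 8 * m ∧ (4 : ℚ) ^ (n - 1) = 16 * m ^ 2 ∧ (4 : ℚ) ^ n = 64 * m ^ 2 := by
  obtain ⟨k, rfl⟩ := Nat.exists_eq_add_of_le' hn
  have h4 : (4 : ℚ) ^ k = (2 ^ k) ^ 2 := by rw [← pow_mul, mul_comm, pow_mul]; norm_num
  refine ⟨2 ^ k, one_le_pow₀ (by norm_num), rfl, ?_, ?_, ?_, ?_⟩
  · rw [show k + 3 - 1 = k + 2 by omega, pow_add]; ring
  · rw [pow_add]; ring
  · rw [show k + 3 - 1 = k + 2 by omega, pow_add, h4]; ring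
  · rw [pow_add, h4]; ring

lemma tableRow_ccLines (hn : 3 ≤ n) (ε : ZMod 2) : TableRow n (ccLines n ε) 3 0 0
    (4 ^ (n - 1) - 1) (1 / 12 * ((4 ^ n - 1) * (4 ^ n - if ε = 0 then 4 else 0))) := by
  obtain ⟨m, -, -, -, -, h4, h5⟩ := exists_pow_eq hn
  constructor
  · rintro l ⟨a, b, ha, hb, hab, -, rfl⟩
    have hne : ((0, a) : ZMod 2 × V n) ≠ (0, b) := fun e => hab (congrArg Prod.snd e)
    have hsize := four_mul_ncard_zeros_inter (0, a) (0, b)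
    rw [Prod.mk_add_mk, add_zero, expSum_linear ha, expSum_linear hb,
      expSum_linear (mt add_eq_zero_iff_eq'.mp hab)] at hsize
    rw [C_eq_zeros, C_eq_zeros, cHyperplanes_eq, hHyperplanes_eq, hHyperplanes_eq]
    refine ⟨?_, ?_, ?_, ?_, ?_⟩
    · rw [ncard_incidentHyperplanes_inter hn _ (linear_ne_zero ha) (linear_ne_zero hb) hne]; simp
    · rw [ncard_incidentHyperplanes_inter hn _ (linear_ne_zero ha) (linear_ne_zero hb) hne]; simp
    · rw [ncard_incidentHyperplanes_inter hn _ (linear_ne_zero ha) (linear_ne_zero hb) hne]; simp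
    · rw [ncard_incidentHyperplanes hn (linear_ne_zero ha) (linear_ne_zero hb) hne]
    · have := congrArg (Int.cast : ℤ → ℚ) hsize
      push_cast at this
      linarith
  · have := congrArg (Int.cast : ℤ → ℚ) (twelve_mul_ncard_ccLines hn ε)
    push_cast at this
    linarith

lemma tableRow_hhLines (hn : 3 ≤ n) (ε δ : ZMod 2) : TableRow n (hhLines n ε δ) 1
    ((if ε = 0 then 1 else 0) + if δ = 0 then 1 else 0)
    ((if ε = 1 then 1 else 0) + if δ = 1 then 1 else 0)
    (4 ^ (n - 1) + (sgn ε + sgn δ) / 2 * 2 ^ (n - 1) - 1) (hhLines n ε δ).ncard := by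
  obtain ⟨m, -, -, h2, h3, h4, h5⟩ := exists_pow_eq hn
  refine ⟨?_, rfl⟩
  rintro l ⟨a, b, hab, ha, hb, rfl⟩
  rw [arf_Q] at ha hb
  have hne : ((1, a) : ZMod 2 × V n) ≠ (1, b) := fun e => hab (congrArg Prod.snd e)
  have h11 : (1 + 1 : ZMod 2) = 0 := rfl
  have hsize := four_mul_ncard_zeros_inter (1, a) (1, b)
  rw [Prod.mk_add_mk, h11, expSum_quadratic, expSum_quadratic,
    expSum_linear (mt add_eq_zero_iff_eq'.mp hab), ha, hb] at hsize
  rw [H_eq_zeros, H_eq_zeros, cHyperplanes_eq, hHyperplanes_eq, hHyperplanes_eq]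
  have h01 : (0 : ZMod 2) ≠ 1 := zero_ne_one
  refine ⟨?_, ?_, ?_, ?_, ?_⟩
  · rw [ncard_incidentHyperplanes_inter hn _ quadratic_ne_zero quadratic_ne_zero hne]; simp [h11]
  · rw [ncard_incidentHyperplanes_inter hn _ quadratic_ne_zero quadratic_ne_zero hne]
    simp [h11, ha, hb]
  · rw [ncard_incidentHyperplanes_inter hn _ quadratic_ne_zero quadratic_ne_zero hne]
    simp [h11, ha, hb]
  · rw [ncard_incidentHyperplanes hn quadratic_ne_zero quadratic_ne_zero hne]
    exact (by decide : ∀ ε δ : ZMod 2, 3 = 1 + ((if ε = 0 then 1 else 0) + if δ = 0 then 1 else 0) +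
      ((if ε = 1 then 1 else 0) + if δ = 1 then 1 else 0)) ε δ
  · have := congrArg (Int.cast : ℤ → ℚ) hsize
    push_cast at this
    rw [h2, h4]
    rw [h3, h5] at this
    linarith

lemma ncard_hhLines_self (hn : 3 ≤ n) (ε : ZMod 2) : ((hhLines n ε ε).ncard : ℚ) =
    2 ^ (n - 3) * (4 ^ n - 1) * (2 ^ n + 2 * sgn ε) := by
  obtain ⟨m, -, h1, h2, h3, h4, h5⟩ := exists_pow_eq hn
  have hc := congrArg (Int.cast : ℤ → ℚ) (two_mul_ncard_hhLines_self hn ε)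
  have hN := congrArg (Int.cast : ℤ → ℚ) (two_mul_card_arfVectors n ε)
  push_cast at hc hN
  rw [h3, h5] at hN
  have hs : (sgn ε : ℚ) * sgn ε = 1 := by exact_mod_cast (by decide : ∀ ε, sgn ε * sgn ε = 1) ε
  have hN' : ((arfVectors n ε).card : ℚ) = 32 * m ^ 2 + 4 * sgn ε * m := by linarith
  rw [hN'] at hc
  rw [h1, h3, h5]
  linear_combination (1 / 2) * hc + 8 * m ^ 2 * hs

lemma ncard_hhLines_zero_one_eq (hn : 3 ≤ n) : ((hhLines n 0 1).ncard : ℚ) =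
    4 ^ (n - 1) * (4 ^ n - 1) := by
  obtain ⟨m, -, h1, h2, h3, h4, h5⟩ := exists_pow_eq hn
  have h0 := congrArg (Int.cast : ℤ → ℚ) (two_mul_card_arfVectors n 0)
  have h1 := congrArg (Int.cast : ℤ → ℚ) (two_mul_card_arfVectors n 1)
  push_cast at h0 h1
  simp only [sgn_zero, sgn_one, Int.cast_one, Int.cast_neg] at h0 h1
  rw [h3, h5] at h0 h1
  have h0' : ((arfVectors n 0).card : ℚ) = 32 * m ^ 2 + 4 * m := by linarith
  have h1' : ((arfVectors n 1).card : ℚ) = 32 * m ^ 2 - 4 * m := by linarith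
  rw [ncard_hhLines_zero_one hn]
  push_cast
  rw [h0', h1', h4, h5]
  ring

/-! ### The orbits are the five classes -/

lemma spOrbit_mem_classes (hn : 3 ≤ n) {l : Set (V n)} (hl : l ∈ (geometry n).veldkampLines) :
    spOrbit l ∈ ({ccLines n 0, ccLines n 1, hhLines n 0 0, hhLines n 0 1, hhLines n 1 1} :
      Set (Set (Set (V n)))) := by
  have hcc : ∀ ε, l ∈ ccLines n ε → spOrbit l ∈ ({ccLines n 0, ccLines n 1, hhLines n 0 0,
      hhLines n 0 1, hhLines n 1 1} : Set (Set (Set (V n)))) := by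
    intro ε h
    rw [spOrbit_ccLines hn h]
    rcases ZMod_two_cases ε with rfl | rfl <;> simp
  have hhh : ∀ a b, a ≠ b → l = H a ∩ H b → spOrbit l ∈ ({ccLines n 0, ccLines n 1, hhLines n 0 0,
      hhLines n 0 1, hhLines n 1 1} : Set (Set (Set (V n)))) := by
    intro a b hab h
    have h1 : l ∈ hhLines n (Q₀ a) (Q₀ b) := ⟨a, b, hab, arf_Q a, arf_Q b, h⟩
    have h2 : l ∈ hhLines n (Q₀ b) (Q₀ a) :=
      ⟨b, a, hab.symm, arf_Q b, arf_Q a, by rw [h, Set.inter_comm]⟩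
    rcases ZMod_two_cases (Q₀ a) with ha | ha <;> rcases ZMod_two_cases (Q₀ b) with hb | hb <;>
      rw [ha, hb] at h1 h2
    · rw [spOrbit_hhLines hn h1]; simp
    · rw [spOrbit_hhLines hn h1]; simp
    · rw [spOrbit_hhLines hn h2]; simp
    · rw [spOrbit_hhLines hn h1]; simp
  -- A mixed intersection is no new class: replacing `C_p` by the third hyperplane gives `H_q ∩
  -- H_{q+p}`.
  have hch : ∀ p q, p ≠ 0 → l = C p ∩ H q → spOrbit l ∈ ({ccLines n 0, ccLines n 1, hhLines n 0 0,
      hhLines n 0 1, hhLines n 1 1} : Set (Set (Set (V n)))) := by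
    intro p q hp h
    refine hhh q (q + p) (by simpa using hp) ?_
    rw [h, Set.inter_comm, H_eq_zeros, C_eq_zeros, zeros_inter_eq, H_eq_zeros, Prod.mk_add_mk,
      add_zero]
  obtain ⟨A, B, hA, hB, hAB, hl⟩ := hl
  obtain ⟨⟨γ, p⟩, hp, rfl⟩ := exists_eq_zeros hn hA
  obtain ⟨⟨δ, q⟩, hq, rfl⟩ := exists_eq_zeros hn hB
  rcases ZMod_two_cases γ with rfl | rfl <;> rcases ZMod_two_cases δ with rfl | rfl
  · refine hcc _ ⟨p, q, fun h => hp (by rw [h]; rfl), fun h => hq (by rw [h]; rfl), ?_, rfl,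
      by rw [hl, C_eq_zeros, C_eq_zeros]⟩
    rintro rfl
    exact hAB rfl
  · exact hch p q (fun h => hp (by rw [h]; rfl)) (by rw [hl, C_eq_zeros, H_eq_zeros])
  · exact hch q p (fun h => hq (by rw [h]; rfl))
      (by rw [hl, C_eq_zeros, H_eq_zeros, Set.inter_comm])
  · refine hhh p q ?_ (by rw [hl, H_eq_zeros, H_eq_zeros])
    rintro rfl
    exact hAB rfl

lemma ccLines_subset_veldkampLines (hn : 3 ≤ n) (ε : ZMod 2) :
    ccLines n ε ⊆ (geometry n).veldkampLines := by
  rintro l ⟨a, b, ha, hb, hab, -, rfl⟩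
  rw [C_eq_zeros, C_eq_zeros]
  exact ⟨_, _, isGeometricHyperplane_zeros hn (linear_ne_zero ha),
    isGeometricHyperplane_zeros hn (linear_ne_zero hb), fun e => hab (congrArg Prod.snd
      (zeros_injOn hn (linear_ne_zero ha) (linear_ne_zero hb) e)), rfl⟩

lemma hhLines_subset_veldkampLines (hn : 3 ≤ n) (ε δ : ZMod 2) :
    hhLines n ε δ ⊆ (geometry n).veldkampLines := by
  rintro l ⟨a, b, hab, -, -, rfl⟩
  refine ⟨_, _, ?_, ?_, (H_injective hn).ne hab, rfl⟩ <;> rw [H_eq_zeros] <;>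
    exact isGeometricHyperplane_zeros hn quadratic_ne_zero

/-- The numbers of lines in the five classes are positive and distinct. -/
lemma classes_ncard_lt (hn : 3 ≤ n) :
    0 < (ccLines n 0).ncard ∧ (ccLines n 0).ncard < (ccLines n 1).ncard ∧
      (ccLines n 1).ncard < (hhLines n 1 1).ncard ∧
      (hhLines n 1 1).ncard < (hhLines n 0 0).ncard ∧
      (hhLines n 0 0).ncard < (hhLines n 0 1).ncard := by
  obtain ⟨m, hm, h1, h2, h3, h4, h5⟩ := exists_pow_eq hn
  have c0 := (tableRow_ccLines hn 0).2
  have c1 := (tableRow_ccLines hn 1).2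
  have d0 := ncard_hhLines_self hn 0
  have d1 := ncard_hhLines_self hn 1
  have d2 := ncard_hhLines_zero_one_eq hn
  rw [if_pos rfl] at c0
  rw [if_neg one_ne_zero] at c1
  rw [sgn_zero] at d0
  rw [sgn_one] at d1
  rw [h1, h3, h5] at d0 d1
  rw [h4, h5] at d2
  rw [h5] at c0 c1
  push_cast at d0 d1
  -- All five counts share the factor `4 ^ n - 1 = 64 * m ^ 2 - 1`, so each comparison reduces to
  -- the cofactors, polynomials in `m ≥ 1`.
  have hM : (0 : ℚ) < 64 * m ^ 2 - 1 := by nlinarith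
  refine ⟨?_, ?_, ?_, ?_, ?_⟩ <;> rw [← Nat.cast_lt (α := ℚ)]
  · rw [c0, Nat.cast_zero]
    have := mul_pos hM (by nlinarith : (0 : ℚ) < 64 * m ^ 2 - 4)
    linarith
  · rw [c0, c1]
    linarith
  · rw [c1, d1]
    have := mul_pos hM (by nlinarith : (0 : ℚ) < 8 * m ^ 2 - 2 * m - 64 * m ^ 2 / 12)
    linarith
  · rw [d1, d0]
    have := mul_pos hM (by linarith : (0 : ℚ) < 4 * m)
    linarith
  · rw [d0, d2]
    have := mul_pos hM (by nlinarith : (0 : ℚ) < 16 * m ^ 2 - 8 * m ^ 2 - 2 * m)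
    linarith

/-- A class is the orbit of any of its members, and the positive counts provide a member. -/
lemma setOf_spOrbit_eq (hn : 3 ≤ n) :
    {O | ∃ l ∈ (geometry n).veldkampLines, O = spOrbit l} =
      {ccLines n 0, ccLines n 1, hhLines n 0 0, hhLines n 0 1, hhLines n 1 1} := by
  obtain ⟨h0, h1, h2, h3, h4⟩ := classes_ncard_lt hn
  ext O
  constructor
  · rintro ⟨l, hl, rfl⟩
    exact spOrbit_mem_classes hn hl
  · have hcc : ∀ ε, 0 < (ccLines n ε).ncard →
        ∃ l ∈ (geometry n).veldkampLines, ccLines n ε = spOrbit l := fun ε h => by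
      obtain ⟨l, hl⟩ := Set.nonempty_of_ncard_ne_zero h.ne'
      exact ⟨l, ccLines_subset_veldkampLines hn ε hl, (spOrbit_ccLines hn hl).symm⟩
    have hhh : ∀ ε δ, 0 < (hhLines n ε δ).ncard →
        ∃ l ∈ (geometry n).veldkampLines, hhLines n ε δ = spOrbit l := fun ε δ h => by
      obtain ⟨l, hl⟩ := Set.nonempty_of_ncard_ne_zero h.ne'
      exact ⟨l, hhLines_subset_veldkampLines hn ε δ hl, (spOrbit_hhLines hn hl).symm⟩
    rintro (rfl | rfl | rfl | rfl | rfl)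
    exacts [hcc 0 (by omega), hcc 1 (by omega), hhh 0 0 (by omega), hhh 0 1 (by omega),
      hhh 1 1 (by omega)]

lemma ncard_classes (hn : 3 ≤ n) :
    ({ccLines n 0, ccLines n 1, hhLines n 0 0, hhLines n 0 1, hhLines n 1 1} :
      Set (Set (Set (V n)))).ncard = 5 := by
  obtain ⟨h0, h1, h2, h3, h4⟩ := classes_ncard_lt hn
  have hne : ∀ {s t : Set (Set (V n))}, s.ncard ≠ t.ncard → s ≠ t := fun h e => h (e ▸ rfl)
  rw [Set.ncard_insert_of_notMem, Set.ncard_insert_of_notMem, Set.ncard_insert_of_notMem,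
    Set.ncard_pair]
  · exact hne (by omega)
  · rintro (h | h) <;> exact hne (by omega) h
  · rintro (h | h | h) <;> exact hne (by omega) h
  · rintro (h | h | h | h) <;> exact hne (by omega) h

end QubitGeometry

theorem mainTheorem4 (n : ℕ) (hn : 3 ≤ n) :
    -- the Veldkamp space of the geometry is defined
    (QubitGeometry.geometry n).HasVeldkampPoints ∧
    (QubitGeometry.geometry n).HasVeldkampLines ∧
    -- the Arf invariant of `Q_p` is `Q₀(p)`
    (∀ p : QubitGeometry.V n, QubitGeometry.arf (QubitGeometry.Q p) = QubitGeometry.Q₀ p) ∧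
    -- the orbits on Veldkamp lines are the following five classes, which are distinct
    {O | ∃ l ∈ (QubitGeometry.geometry n).veldkampLines, O = QubitGeometry.spOrbit l} =
      {QubitGeometry.ccLines n 0, QubitGeometry.ccLines n 1, QubitGeometry.hhLines n 0 0,
        QubitGeometry.hhLines n 0 1, QubitGeometry.hhLines n 1 1} ∧
    {O | ∃ l ∈ (QubitGeometry.geometry n).veldkampLines, O = QubitGeometry.spOrbit l}.ncard = 5 ∧
    -- the data of each class
    QubitGeometry.TableRow n (QubitGeometry.ccLines n 0) 3 0 0
      (4 ^ (n - 1) - 1) (1 / 3 * (4 ^ n - 1) * (4 ^ (n - 1) - 1)) ∧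
    QubitGeometry.TableRow n (QubitGeometry.ccLines n 1) 3 0 0
      (4 ^ (n - 1) - 1) (1 / 3 * 4 ^ (n - 1) * (4 ^ n - 1)) ∧
    QubitGeometry.TableRow n (QubitGeometry.hhLines n 0 0) 1 2 0
      (4 ^ (n - 1) + 2 ^ (n - 1) - 1) (2 ^ (n - 3) * (4 ^ n - 1) * (2 ^ n + 2)) ∧
    QubitGeometry.TableRow n (QubitGeometry.hhLines n 0 1) 1 1 1
      (4 ^ (n - 1) - 1) (4 ^ (n - 1) * (4 ^ n - 1)) ∧
    QubitGeometry.TableRow n (QubitGeometry.hhLines n 1 1) 1 0 2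
      (4 ^ (n - 1) - 2 ^ (n - 1) - 1) (2 ^ (n - 3) * (4 ^ n - 1) * (2 ^ n - 2)) := by
  open QubitGeometry in
  refine ⟨hasVeldkampPoints hn, hasVeldkampLines hn, arf_Q, setOf_spOrbit_eq hn,
    by rw [setOf_spOrbit_eq hn, ncard_classes hn], ?_, ?_, ?_, ?_, ?_⟩
  all_goals obtain ⟨m, -, h1, h2, h3, h4, h5⟩ := QubitGeometry.exists_pow_eq hn
  · convert QubitGeometry.tableRow_ccLines hn 0 using 1
    rw [if_pos rfl, h4, h5]
    ring
  · convert QubitGeometry.tableRow_ccLines hn 1 using 1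
    rw [if_neg one_ne_zero, h4, h5]
    ring
  · convert QubitGeometry.tableRow_hhLines hn 0 0 using 1
    · simp
    · simp
    · simp
    · rw [QubitGeometry.ncard_hhLines_self hn]
      simp
  · convert QubitGeometry.tableRow_hhLines hn 0 1 using 1
    · simp
    · simp
    · simp
    · rw [QubitGeometry.ncard_hhLines_zero_one_eq hn]
  · convert QubitGeometry.tableRow_hhLines hn 1 1 using 1
    · simp
    · simp
    · simp only [QubitGeometry.sgn_one]
      push_cast
      ring
    · rw [QubitGeometry.ncard_hhLines_self hn, QubitGeometry.sgn_one]
      push_cast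
      ring
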